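/- Let $\mathbb X$ be an effective orbifold of dimension $n$: a paracompact Hausdorff space $\mathsf X$ with a (maximal) atlas of orbifold charts $(V,\Gamma,\phi)$, where $V\subset\mathbb R^n$ is open and connected, $\Gamma$ is a finite group acting smoothly and effectively on $V$, and $\phi:V\to\mathsf X$ is a $\Gamma$-invariant continuous map inducing a homeomorphism of $V/\Gamma$ onto an open subset of $\mathsf X$; any two charts are locally compatible via smooth equivariant embeddings of charts. Let $2\le k\le\infty$. A function $f:\mathsf X\to\mathbb R$ is a $C^k$ Morse function on $\mathbb X$ if for every orbifold chart the function $f\circ\phi:V\to\mathbb R$ is of class $C^k$ and all its critical points are nondegenerate; a point $p\in\mathsf X$ is critical for $f$ if some lift $\tilde p$ of $p$ to an orbifold chart is a critical point of $f\circ\phi$. A critical point $p$ is stable if there are an orbifold chart $(V,\Gamma,\phi)$ and a lift $\tilde p\in V$ of $p$ such that the stabilizer of $\tilde p$ in $\Gamma$ acts trivially on the negative eigenspace of the Hessian of $f\circ\phi$ at $\tilde p$ (the span of the eigenvectors with negative eigenvalue, taken with respect to an inner product on $T_{\tilde p}V$ that is invariant under the stabilizer). A Morse function is stable if all its critical points are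 stable. Let $f$ be a $C^k$ Morse function on $\mathbb X$. Then for every continuous function $\varepsilon:\mathsf X\to(0,\infty)$ (for instance a positive constant) and every open set $U\subset\mathsf X$ containing all critical points of $f$, there is a stable $C^k$ Morse function $f'$ on $\mathbb X$ such that $|f'(x)-f(x)|<\varepsilon(x)$ for all $x\in\mathsf X$ and $f'(x)=f(x)$ for all $x\in\mathsf X\setminus U$. -/

import Mathlib

open scoped ContDiff

/-- An `n`-dimensional orbifold chart `(V, Γ, φ)` on a topological space `X`: a connected open
`V ⊆ ℝⁿ`, a finite group `Γ` acting smoothly and effectively on `V`, and a `Γ`-invariant continuous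
map `φ : V → X` inducing a homeomorphism of `V / Γ` onto an open subset of `X`.
The maps `act γ` and `φ` are given on all of `ℝⁿ`, but only their restrictions to `V` matter. -/
structure OrbifoldChart (n : ℕ) (X : Type*) [TopologicalSpace X] where
  V : Set (EuclideanSpace ℝ (Fin n))
  isOpen_V : IsOpen V
  isConnected_V : IsConnected V
  Γ : Type
  [group : Group Γ]
  [finite : Finite Γ]
  act : Γ → EuclideanSpace ℝ (Fin n) → EuclideanSpace ℝ (Fin n)
  act_mem : ∀ γ, ∀ x ∈ V, act γ x ∈ V
  act_one : ∀ x ∈ V, act 1 x = x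
  act_mul : ∀ γ δ, ∀ x ∈ V, act (γ * δ) x = act γ (act δ x)
  act_smooth : ∀ γ, ContDiffOn ℝ ∞ (act γ) V
  act_effective : ∀ γ, (∀ x ∈ V, act γ x = x) → γ = 1
  φ : EuclideanSpace ℝ (Fin n) → X
  φ_continuousOn : ContinuousOn φ V
  /-- The fibres of `φ` on `V` are the `Γ`-orbits: `φ` is invariant and `V / Γ → X` is injective. -/
  φ_eq_iff : ∀ x ∈ V, ∀ y ∈ V, φ x = φ y ↔ ∃ γ, act γ x = y
  /-- `φ` is open on `V`. As `V → V / Γ` is an open continuous surjection, this says that the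
  continuous injection `V / Γ → X` is open, i.e. a homeomorphism onto an open subset. -/
  φ_isOpen_image : ∀ W ⊆ V, IsOpen W → IsOpen (φ '' W)

attribute [instance] OrbifoldChart.group OrbifoldChart.finite

namespace OrbifoldChart

variable {n : ℕ} {X : Type*} [TopologicalSpace X]

/-- There is an embedding of orbifold charts `(ψ, θ) : c → c'`: a smooth embedding `ψ : V → V'`
over `X`, equivariant along an injective group homomorphism `θ : Γ → Γ'`. (The dimensions
agree, so an injective immersion is a diffeomorphism onto an open subset.) -/
def EmbedsIn (c c' : OrbifoldChart n X) : Prop :=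
  ∃ (ψ : EuclideanSpace ℝ (Fin n) → EuclideanSpace ℝ (Fin n)) (θ : c.Γ →* c'.Γ),
    ContDiffOn ℝ ∞ ψ c.V ∧
    Set.MapsTo ψ c.V c'.V ∧
    Set.InjOn ψ c.V ∧
    (∀ x ∈ c.V, Function.Injective (fderiv ℝ ψ x)) ∧
    (∀ x ∈ c.V, c'.φ (ψ x) = c.φ x) ∧
    Function.Injective θ ∧
    (∀ γ, ∀ x ∈ c.V, ψ (c.act γ x) = c'.act (θ γ) (ψ x))

/-- Local compatibility: every point in the overlap of the images has a neighbourhood which is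
the image of a chart embedding into both charts. -/
def Compatible (c c' : OrbifoldChart n X) : Prop :=
  ∀ x ∈ c.φ '' c.V ∩ c'.φ '' c'.V,
    ∃ d : OrbifoldChart n X, x ∈ d.φ '' d.V ∧ d.EmbedsIn c ∧ d.EmbedsIn c'

/-- The stabilizer of a point `x` of the chart. -/
def stab (c : OrbifoldChart n X) (x : EuclideanSpace ℝ (Fin n)) : Set c.Γ :=
  {γ | c.act γ x = x}

end OrbifoldChart

/-- The structure of an `n`-dimensional effective orbifold on `X`, presented by an orbifold
atlas. (The space `X` is in addition required to be paracompact and Hausdorff.) -/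
structure OrbifoldStructure (n : ℕ) (X : Type*) [TopologicalSpace X] where
  atlas : Set (OrbifoldChart n X)
  covers : ∀ x : X, ∃ c ∈ atlas, x ∈ c.φ '' c.V
  compatible : ∀ c ∈ atlas, ∀ c' ∈ atlas, c.Compatible c'

/-- The Hessian of `h : ℝⁿ → ℝ` at `x`, as a bilinear form. -/
noncomputable def hessian {n : ℕ} (h : EuclideanSpace ℝ (Fin n) → ℝ)
    (x : EuclideanSpace ℝ (Fin n)) :
    EuclideanSpace ℝ (Fin n) →L[ℝ] EuclideanSpace ℝ (Fin n) →L[ℝ] ℝ :=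
  fderiv ℝ (fderiv ℝ h) x

/-- `h` is a Morse function of class `C^k` on the open set `V`. -/
def IsMorseOn {n : ℕ} (k : ℕ∞) (V : Set (EuclideanSpace ℝ (Fin n)))
    (h : EuclideanSpace ℝ (Fin n) → ℝ) : Prop :=
  ContDiffOn ℝ k h V ∧
    ∀ x ∈ V, fderiv ℝ h x = 0 → ∀ v, (∀ w, hessian h x v w = 0) → v = 0

/-- The bilinear form `B` is an inner product on the tangent space `T_x V = ℝⁿ` which is
invariant under the linear action of the stabilizer of `x`. -/
def IsInvariantInner {n : ℕ} {X : Type*} [TopologicalSpace X] (c : OrbifoldChart n X)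
    (x : EuclideanSpace ℝ (Fin n))
    (B : EuclideanSpace ℝ (Fin n) →L[ℝ] EuclideanSpace ℝ (Fin n) →L[ℝ] ℝ) : Prop :=
  (∀ v w, B v w = B w v) ∧ (∀ v, v ≠ 0 → 0 < B v v) ∧
    ∀ γ ∈ c.stab x, ∀ v w,
      B (fderiv ℝ (c.act γ) x v) (fderiv ℝ (c.act γ) x w) = B v w

/-- The span of the eigenvectors for negative eigenvalues of the bilinear form `Q`, with respect
to the inner product `B`. -/
def negEigenspace {n : ℕ}
    (B Q : EuclideanSpace ℝ (Fin n) →L[ℝ] EuclideanSpace ℝ (Fin n) →L[ℝ] ℝ) :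
    Submodule ℝ (EuclideanSpace ℝ (Fin n)) :=
  Submodule.span ℝ {v | ∃ μ : ℝ, μ < 0 ∧ ∀ w, Q v w = μ * B v w}

namespace OrbifoldStructure

variable {n : ℕ} {X : Type*} [TopologicalSpace X]

/-- The orbifold charts of the orbifold: the members of the maximal atlas, i.e. all charts that
are compatible with the charts of the given atlas. -/
def IsChart (O : OrbifoldStructure n X) (c : OrbifoldChart n X) : Prop :=
  ∀ c' ∈ O.atlas, c.Compatible c'

/-- `f` is a Morse function of class `C^k` on the orbifold: all its local representatives
`f ∘ φ : V → ℝ` are. -/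
def IsMorse (O : OrbifoldStructure n X) (k : ℕ∞) (f : X → ℝ) : Prop :=
  ∀ c, O.IsChart c → IsMorseOn k c.V (f ∘ c.φ)

/-- `p` is a critical point of `f`: some lift of `p` to some orbifold chart is a critical point
of the local representative. -/
def IsCritical (O : OrbifoldStructure n X) (f : X → ℝ) (p : X) : Prop :=
  ∃ c, O.IsChart c ∧ ∃ x ∈ c.V, c.φ x = p ∧ fderiv ℝ (f ∘ c.φ) x = 0

/-- The critical point `p` of `f` is stable: in some orbifold chart, the stabilizer of some lift
of `p` acts trivially on the negative eigenspace of the Hessian. Eigenvectors are taken with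
respect to an inner product invariant under the stabilizer, so that the stabilizer does act on
this eigenspace. -/
def IsStableAt (O : OrbifoldStructure n X) (f : X → ℝ) (p : X) : Prop :=
  ∃ c, O.IsChart c ∧ ∃ x ∈ c.V, c.φ x = p ∧
    ∃ B, IsInvariantInner c x B ∧
      ∀ γ ∈ c.stab x, ∀ v ∈ negEigenspace B (hessian (f ∘ c.φ) x),
        fderiv ℝ (c.act γ) x v = v

/-- `f` is a stable Morse function of class `C^k`. -/
def IsStableMorse (O : OrbifoldStructure n X) (k : ℕ∞) (f : X → ℝ) : Prop :=
  O.IsMorse k f ∧ ∀ p, O.IsCritical f p → O.IsStableAt f p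

end OrbifoldStructure

open scoped ContDiff InnerProductSpace

open Filter Topology Metric Set

/-! A critical point `p` is treated in coordinates that make its stabilizer `Γ` act by linear
isometries (`exists_linearization`). There `f` becomes an invariant function `g` on a ball whose
only critical point is the origin. Let `L` be the subspace fixed by `Γ`. At an invariant critical
point the Hessian is block diagonal for the splitting into `L` and its orthogonal complement
(`hessian_block`). If the block across `L` is positive definite, every negative eigenvector lies in
`L`, and the point is stable (`isStableAt_of_linear`).

To reach this, a large multiple of the squared distance to `L`, cut off near the origin, is added to
`g`. Shrinking the support makes the added function uniformly small, although its second derivatives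
stay large. On `L` it attains its minimum `0`, so no critical points arise there, and the origin
becomes stable. Critical points created off `L` have strictly smaller stabilizers, but may be
degenerate.

Degeneracy is removed by invariant, `C²`-small perturbations, one isotropy order at a time from the
largest down (`exists_linear_step`). Near a point with isotropy group `T`, a linear term along the
fixed space of `T`, chosen by Sard's theorem, handles tangential directions, and a multiple of the
squared distance to that space handles normal ones. Goodness on a compact set is open in the `C²`
topology, so what was achieved before survives.

The invariant perturbation descends to the orbifold (`exists_modification`). Each new critical point
near `p` is either stable or has a smaller stabilizer, so induction on the order of the stabilizer
finishes the local problem (`stabilizable`). Critical points being isolated, the local modifications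
are carried out together in disjoint, locally finite neighbourhoods
(`exists_stable_of_forall_stabilizable`). -/

/-- The standard Euclidean space of dimension `n`. -/
abbrev Euc (n : ℕ) := EuclideanSpace ℝ (Fin n)

/-! ### Sum and chain rules for the Hessian. -/

section Calculus

variable {n : ℕ}

theorem hessian_congr {f g : Euc n → ℝ} {x : Euc n} (h : f =ᶠ[𝓝 x] g) :
    hessian f x = hessian g x :=
  h.fderiv.fderiv_eq

theorem ContDiffAt.differentiableAt_fderiv {f : Euc n → ℝ} {x : Euc n}
    (h : ContDiffAt ℝ 2 f x) : DifferentiableAt ℝ (fderiv ℝ f) x :=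
  (h.fderiv_right (m := 1) (by norm_num)).differentiableAt (by norm_num)

theorem ContDiffAt.eventually_differentiableAt {f : Euc n → ℝ} {x : Euc n}
    (h : ContDiffAt ℝ 2 f x) : ∀ᶠ y in 𝓝 x, DifferentiableAt ℝ f y := by
  filter_upwards [h.eventually (by simp)] with y hy
  exact hy.differentiableAt (by norm_num)

theorem fderiv_add_eventuallyEq {f g : Euc n → ℝ} {x : Euc n} (hf : ContDiffAt ℝ 2 f x)
    (hg : ContDiffAt ℝ 2 g x) :
    fderiv ℝ (f + g) =ᶠ[𝓝 x] fun y => fderiv ℝ f y + fderiv ℝ g y := by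
  filter_upwards [hf.eventually_differentiableAt, hg.eventually_differentiableAt] with y h1 h2
  exact fderiv_add h1 h2

theorem hessian_add {f g : Euc n → ℝ} {x : Euc n} (hf : ContDiffAt ℝ 2 f x)
    (hg : ContDiffAt ℝ 2 g x) : hessian (f + g) x = hessian f x + hessian g x := by
  unfold hessian
  rw [(fderiv_add_eventuallyEq hf hg).fderiv_eq]
  exact fderiv_add hf.differentiableAt_fderiv hg.differentiableAt_fderiv

/-- The second derivative of `e` enters the chain rule only through `fderiv ℝ h (e x)`, which is
zero; so at a critical point the Hessian transforms as a tensor. -/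
theorem hessian_comp_of_critical {h : Euc n → ℝ} {e : Euc n → Euc n} {x : Euc n}
    (he : ContDiffAt ℝ 2 e x) (hh : ContDiffAt ℝ 2 h (e x)) (hc : fderiv ℝ h (e x) = 0)
    (v w : Euc n) :
    hessian (h ∘ e) x v w = hessian h (e x) (fderiv ℝ e x v) (fderiv ℝ e x w) := by
  have h1 : fderiv ℝ (h ∘ e) =ᶠ[𝓝 x] fun y => (fderiv ℝ h (e y)).comp (fderiv ℝ e y) := by
    have hev : ∀ᶠ y in 𝓝 x, DifferentiableAt ℝ e y := by
      filter_upwards [he.eventually (by simp)] with y hy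
      exact hy.differentiableAt (by norm_num)
    filter_upwards [hev, he.continuousAt.eventually hh.eventually_differentiableAt] with y h1 h2
    exact fderiv_comp y h2 h1
  have hd : HasFDerivAt (fderiv ℝ e) (fderiv ℝ (fderiv ℝ e) x) x :=
    ((he.fderiv_right (m := 1) (by norm_num)).differentiableAt (by norm_num)).hasFDerivAt
  have hd2 : HasFDerivAt (fun y => fderiv ℝ h (e y))
      ((fderiv ℝ (fderiv ℝ h) (e x)).comp (fderiv ℝ e x)) x :=
    hh.differentiableAt_fderiv.hasFDerivAt.comp x
      (he.differentiableAt (by norm_num)).hasFDerivAt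
  have h2 := (hd2.clm_comp hd).fderiv
  unfold hessian
  rw [h1.fderiv_eq, h2]
  simp [hc]

theorem fderiv_comp_eq_zero {h : Euc n → ℝ} {e : Euc n → Euc n} {x : Euc n}
    (he : DifferentiableAt ℝ e x) (hh : DifferentiableAt ℝ h (e x))
    (hc : fderiv ℝ h (e x) = 0) : fderiv ℝ (h ∘ e) x = 0 := by
  rw [fderiv_comp x hh he, hc, ContinuousLinearMap.zero_comp]

end Calculus

/-! ### The Morse condition at a point. -/

/-- `h` is of class `C^k` at `x`, and `x` is not a degenerate critical point of `h`. -/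
def MorseAt {n : ℕ} (k : ℕ∞) (h : Euc n → ℝ) (x : Euc n) : Prop :=
  ContDiffAt ℝ k h x ∧ (fderiv ℝ h x = 0 → ∀ v, (∀ w, hessian h x v w = 0) → v = 0)

section Morse

variable {n : ℕ} {k : ℕ∞}

theorem isMorseOn_iff {V : Set (Euc n)} (hV : IsOpen V) {h : Euc n → ℝ} :
    IsMorseOn k V h ↔ ∀ x ∈ V, MorseAt k h x := by
  refine ⟨fun H x hx => ⟨H.1.contDiffAt (hV.mem_nhds hx), H.2 x hx⟩, fun H => ⟨?_, ?_⟩⟩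
  · exact fun x hx => (H x hx).1.contDiffWithinAt
  · exact fun x hx => (H x hx).2

theorem MorseAt.congr {f g : Euc n → ℝ} {x : Euc n} (h : f =ᶠ[𝓝 x] g) (hf : MorseAt k f x) :
    MorseAt k g x := by
  refine ⟨hf.1.congr_of_eventuallyEq h.symm, ?_⟩
  rw [← h.fderiv_eq, ← hessian_congr h]
  exact hf.2

theorem two_le_coe {k : ℕ∞} (hk : 2 ≤ k) : (2 : WithTop ℕ∞) ≤ (k : WithTop ℕ∞) :=
  WithTop.coe_le_coe.2 hk

theorem MorseAt.contDiffAt_two (hk : 2 ≤ k) {f : Euc n → ℝ} {x : Euc n} (hf : MorseAt k f x) :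
    ContDiffAt ℝ 2 f x :=
  hf.1.of_le (two_le_coe hk)

/-- A nondegenerate critical point is isolated among the critical points. -/
theorem MorseAt.eventually_fderiv_ne_zero (hk : 2 ≤ k) {f : Euc n → ℝ} {x : Euc n}
    (hf : MorseAt k f x) : ∀ᶠ y in 𝓝[≠] x, fderiv ℝ f y ≠ 0 := by
  have h2 := hf.contDiffAt_two hk
  by_cases hc : fderiv ℝ f x = 0
  · have hinj : Function.Injective (fderiv ℝ (fderiv ℝ f) x) := by
      rw [injective_iff_map_eq_zero]
      intro v hv
      refine hf.2 hc v fun w => ?_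
      change fderiv ℝ (fderiv ℝ f) x v w = 0
      rw [hv]; rfl
    -- An injective linear map on a finite-dimensional space is bounded below, so `fderiv ℝ f` does
    -- not return to its value at `x` nearby.
    obtain ⟨K, hK, hanti⟩ :=
      (fderiv ℝ (fderiv ℝ f) x).toLinearMap.exists_antilipschitzWith (LinearMap.ker_eq_bot.2 hinj)
    exact h2.differentiableAt_fderiv.hasFDerivAt.eventually_ne ⟨K, hanti⟩
  · have hcont : ContinuousAt (fderiv ℝ f) x := h2.differentiableAt_fderiv.continuousAt
    exact (hcont.eventually_ne hc).filter_mono nhdsWithin_le_nhds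

end Morse

/-! ### Partial diffeomorphisms and invariance of the Morse condition. -/

/-- A partial diffeomorphism of Euclidean space: a partial homeomorphism that is smooth together
with its inverse. -/
def OpenPartialHomeomorph.IsDiffeo {n : ℕ} (e : OpenPartialHomeomorph (Euc n) (Euc n)) : Prop :=
  ContDiffOn ℝ ∞ e e.source ∧ ContDiffOn ℝ ∞ e.symm e.target

namespace OpenPartialHomeomorph.IsDiffeo

variable {n : ℕ} {e e' : OpenPartialHomeomorph (Euc n) (Euc n)} {x : Euc n}

theorem symm (h : e.IsDiffeo) : e.symm.IsDiffeo := ⟨h.2, h.1⟩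

theorem contDiffAt (h : e.IsDiffeo) (hx : x ∈ e.source) : ContDiffAt ℝ ∞ e x :=
  h.1.contDiffAt (e.open_source.mem_nhds hx)

theorem contDiffAt' (h : e.IsDiffeo) {k : ℕ∞} (hx : x ∈ e.source) : ContDiffAt ℝ k e x :=
  (h.contDiffAt hx).of_le (by exact_mod_cast le_top)

theorem differentiableAt (h : e.IsDiffeo) (hx : x ∈ e.source) : DifferentiableAt ℝ e x :=
  (h.contDiffAt hx).differentiableAt (by simp)

theorem trans (h : e.IsDiffeo) (h' : e'.IsDiffeo) : (e.trans e').IsDiffeo := by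
  constructor
  · intro y hy
    rw [OpenPartialHomeomorph.trans_source] at hy
    exact ((h'.contDiffAt hy.2).comp y (h.contDiffAt hy.1)).contDiffWithinAt
  · intro y hy
    rw [OpenPartialHomeomorph.trans_target] at hy
    exact ((h.symm.contDiffAt hy.2).comp y (h'.symm.contDiffAt hy.1)).contDiffWithinAt

theorem restrOpen (h : e.IsDiffeo) {s : Set (Euc n)} (hs : IsOpen s) :
    (e.restrOpen s hs).IsDiffeo := by
  constructor
  · exact h.1.mono (by simp)
  · exact h.2.mono fun y hy => hy.1

theorem fderiv_symm_comp (h : e.IsDiffeo) (hx : x ∈ e.source) (v : Euc n) :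
    fderiv ℝ e.symm (e x) (fderiv ℝ e x v) = v := by
  have h1 : e.symm ∘ e =ᶠ[𝓝 x] id := by
    filter_upwards [e.open_source.mem_nhds hx] with y hy using e.left_inv hy
  have h2 := h1.fderiv_eq (𝕜 := ℝ)
  rw [fderiv_comp x (h.symm.differentiableAt (e.map_source hx)) (h.differentiableAt hx),
    fderiv_id] at h2
  exact congrArg (fun T => T v) h2

theorem fderiv_comp_symm (h : e.IsDiffeo) (hx : x ∈ e.source) (v : Euc n) :
    fderiv ℝ e x (fderiv ℝ e.symm (e x) v) = v := by
  have := h.symm.fderiv_symm_comp (e.map_source hx) v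
  rwa [e.symm_symm, e.left_inv hx] at this

theorem fderiv_injective (h : e.IsDiffeo) (hx : x ∈ e.source) :
    Function.Injective (fderiv ℝ e x) :=
  Function.LeftInverse.injective (h.fderiv_symm_comp hx)

theorem fderiv_comp_eq_zero_iff (h : e.IsDiffeo) (hx : x ∈ e.source) {g : Euc n → ℝ}
    (hg : DifferentiableAt ℝ g (e x)) : fderiv ℝ (g ∘ e) x = 0 ↔ fderiv ℝ g (e x) = 0 := by
  refine ⟨fun H => ?_, fderiv_comp_eq_zero (h.differentiableAt hx) hg⟩
  rw [fderiv_comp x hg (h.differentiableAt hx)] at H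
  ext v
  rw [← h.fderiv_comp_symm hx v]
  exact congrArg (fun T => T (fderiv ℝ e.symm (e x) v)) H

theorem morseAt_comp (h : e.IsDiffeo) (hx : x ∈ e.source) {k : ℕ∞} (hk : 2 ≤ k)
    {g : Euc n → ℝ} (hg : MorseAt k g (e x)) : MorseAt k (g ∘ e) x := by
  have h2 := hg.contDiffAt_two hk
  refine ⟨hg.1.comp x (h.contDiffAt' hx), fun hc v hv => ?_⟩
  rw [h.fderiv_comp_eq_zero_iff hx (h2.differentiableAt (by norm_num))] at hc
  apply h.fderiv_injective hx
  rw [map_zero]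
  refine hg.2 hc _ fun w => ?_
  rw [← h.fderiv_comp_symm hx w, ← hessian_comp_of_critical (h.contDiffAt' (k := 2) hx) h2 hc]
  exact hv _

end OpenPartialHomeomorph.IsDiffeo

/-- The inverse function theorem, with smoothness on the whole source. -/
theorem exists_isDiffeo_of_injective_fderiv {n : ℕ} {ψ : Euc n → Euc n} {V : Set (Euc n)}
    (hV : IsOpen V) (hψ : ContDiffOn ℝ ∞ ψ V) {x : Euc n} (hx : x ∈ V)
    (hinj : Function.Injective (fderiv ℝ ψ x)) :
    ∃ e : OpenPartialHomeomorph (Euc n) (Euc n), e.IsDiffeo ∧ x ∈ e.source ∧ e.source ⊆ V ∧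
      ∀ y, e y = ψ y := by
  have hψx : ContDiffAt ℝ ∞ ψ x := hψ.contDiffAt (hV.mem_nhds hx)
  let A : Euc n ≃L[ℝ] Euc n :=
    (LinearEquiv.ofInjectiveEndo (fderiv ℝ ψ x).toLinearMap hinj).toContinuousLinearEquiv
  have hA : (A : Euc n →L[ℝ] Euc n) = fderiv ℝ ψ x := by ext v; rfl
  have hd : HasFDerivAt ψ (A : Euc n →L[ℝ] Euc n) x := by
    rw [hA]; exact (hψx.differentiableAt (by simp)).hasFDerivAt
  let e₀ := hψx.toOpenPartialHomeomorph ψ hd (by simp)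
  have he₀ : ∀ y, e₀ y = ψ y := fun y => rfl
  have hx₀ : x ∈ e₀.source := hψx.mem_toOpenPartialHomeomorph_source hd (by simp)
  have hcont : ContinuousOn (fderiv ℝ ψ) V := hψ.continuousOn_fderiv_of_isOpen hV (by simp)
  -- Invertible derivatives form an open set. Cutting the source down to it makes the local inverse
  -- smooth at every point of the target, not just at the image of `x`.
  let W : Set (Euc n) := V ∩ fderiv ℝ ψ ⁻¹' (range ((↑) : (Euc n ≃L[ℝ] Euc n) → _))
  have hW : IsOpen W := hcont.isOpen_inter_preimage hV ContinuousLinearEquiv.isOpen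
  refine ⟨e₀.restrOpen W hW, ⟨?_, ?_⟩, ?_, ?_, he₀⟩
  · intro y hy
    rw [OpenPartialHomeomorph.restrOpen_source] at hy
    exact ((hψ.contDiffAt (hV.mem_nhds hy.2.1)).congr_of_eventuallyEq
      (Eventually.of_forall he₀)).contDiffWithinAt
  · intro y hy
    have hs := (e₀.restrOpen W hW).map_target hy
    rw [OpenPartialHomeomorph.restrOpen_source] at hs
    obtain ⟨T, hT⟩ := hs.2.2
    have hc : ContDiffAt ℝ ∞ ψ ((e₀.restrOpen W hW).symm y) :=
      hψ.contDiffAt (hV.mem_nhds hs.2.1)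
    refine ((e₀.restrOpen W hW).contDiffAt_symm (f₀' := T) hy ?_ ?_).contDiffWithinAt
    · rw [hT]; exact (hc.differentiableAt (by simp)).hasFDerivAt
    · exact hc
  · rw [OpenPartialHomeomorph.restrOpen_source]
    exact ⟨hx₀, hx, A, hA⟩
  · rw [OpenPartialHomeomorph.restrOpen_source]
    exact fun y hy => hy.2.1

/-! ### Sard's theorem and generic linear and quadratic perturbations. -/

section Sard

variable {n : ℕ}

/-- On a Euclidean subspace, small linear perturbations of a `C²` function with only nondegenerate
critical points exist, and these critical points are finite in number on compact sets. -/
theorem exists_regular_value {L : Submodule ℝ (Euc n)} {F : Euc n → ℝ} {O B : Set (Euc n)}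
    (hF : ∀ x ∈ O, ContDiffAt ℝ 2 F x) (hB : IsCompact B) (hBO : B ⊆ O) {t : ℝ} (ht : 0 < t) :
    ∃ a ∈ L, ‖a‖ < t ∧ {x | x ∈ B ∧ x ∈ L ∧ ∀ l ∈ L, fderiv ℝ F x l + ⟪a, l⟫_ℝ = 0}.Finite ∧
      ∀ x ∈ B, x ∈ L → (∀ l ∈ L, fderiv ℝ F x l + ⟪a, l⟫_ℝ = 0) →
        ∀ l ∈ L, (∀ l' ∈ L, hessian F x l l' = 0) → l = 0 := by
  classical
  let b := stdOrthonormalBasis ℝ L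
  -- Minus the Riesz vector of the restriction to `L`: criticality along `L` after adding the linear
  -- term `a` becomes the equation `Ψ x = a`.
  let Λ : (Euc n →L[ℝ] ℝ) →L[ℝ] L :=
    -∑ i, (ContinuousLinearMap.apply ℝ ℝ (b i : Euc n)).smulRight (b i)
  have hΛ : ∀ ℓ, Λ ℓ = -∑ i, ℓ (b i : Euc n) • b i := fun ℓ => by
    simp [Λ]
  have hΛ' : ∀ ℓ : Euc n →L[ℝ] ℝ, ∀ a : L, (∀ l ∈ L, ℓ l + ⟪(a : Euc n), l⟫_ℝ = 0) → Λ ℓ = a := by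
    intro ℓ a h
    rw [hΛ, ← Finset.sum_neg_distrib]
    conv_rhs => rw [← b.sum_repr' a]
    refine Finset.sum_congr rfl fun i _ => ?_
    rw [← neg_smul, Submodule.coe_inner, real_inner_comm, neg_eq_of_add_eq_zero_right (h _ (b i).2)]
  let Ψ : L → L := fun x => Λ (fderiv ℝ F x)
  let Ψ' : L → L →L[ℝ] L := fun x => Λ.comp ((fderiv ℝ (fderiv ℝ F) x).comp L.subtypeL)
  have hΨ : ∀ x : L, (x : Euc n) ∈ O → HasFDerivAt Ψ (Ψ' x) x := fun x hx =>
    Λ.hasFDerivAt.comp x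
      ((hF x hx).differentiableAt_fderiv.hasFDerivAt.comp x L.subtypeL.hasFDerivAt)
  let s : Set L := {x | (x : Euc n) ∈ O ∧ (Ψ' x).det = 0}
  -- The equidimensional case of Sard's theorem needs only differentiability of the gradient map, so
  -- `C²` is enough for `F`.
  have hs : MeasureTheory.Measure.addHaar (Ψ '' s) = 0 :=
    MeasureTheory.addHaar_image_eq_zero_of_det_fderivWithin_eq_zero _
      (fun x hx => (hΨ x hx.1).hasFDerivWithinAt) (fun x hx => hx.2)
  obtain ⟨a, hat, ha⟩ : ∃ a ∈ ball (0 : L) t, a ∉ Ψ '' s := by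
    by_contra! h
    have h1 : MeasureTheory.Measure.addHaar (ball (0 : L) t) = 0 :=
      MeasureTheory.measure_mono_null h hs
    exact (isOpen_ball.measure_pos _ ⟨0, mem_ball_self ht⟩).ne' h1
  have hinj : ∀ x : L, (x : Euc n) ∈ O → Ψ x = a → Function.Injective (Ψ' x) := by
    intro x hx hxa
    have hdet : (Ψ' x).det ≠ 0 := fun h0 => ha ⟨x, ⟨hx, h0⟩, hxa⟩
    by_contra hni
    apply hdet
    refine LinearMap.det_eq_zero_iff_ker_ne_bot.2 fun hk => hni (LinearMap.ker_eq_bot.1 hk)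
  refine ⟨a, a.2, by simpa using hat, ?_, ?_⟩
  · set Z : Set L := {x | (x : Euc n) ∈ B ∧ Ψ x = a}
    have hZ : Z.Finite := by
      by_contra hZ
      have hcpt : IsCompact ((↑) ⁻¹' B : Set L) :=
        (L.closed_of_finiteDimensional.isClosedEmbedding_subtypeVal).isCompact_preimage hB
      obtain ⟨x, hxB, hacc⟩ :=
        -- An accumulation point of solutions is impossible: if it solves the equation, injectivity
        -- of `Ψ'` isolates it; if not, continuity keeps solutions away.
        Set.Infinite.exists_accPt_of_subset_isCompact hZ hcpt (fun y hy => hy.1)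
      have hxO : (x : Euc n) ∈ O := hBO hxB
      rw [accPt_iff_frequently_nhdsNE] at hacc
      by_cases hxa : Ψ x = a
      · obtain ⟨K, hK, hanti⟩ :=
          (Ψ' x).toLinearMap.exists_antilipschitzWith (LinearMap.ker_eq_bot.2 (hinj x hxO hxa))
        have := (hΨ x hxO).eventually_ne (c := a) ⟨K, hanti⟩
        obtain ⟨y, hy, hy'⟩ := (hacc.and_eventually this).exists
        exact hy' hy.2
      · have := ((hΨ x hxO).continuousAt.eventually_ne hxa).filter_mono
          (nhdsWithin_le_nhds (s := {x}ᶜ))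
        obtain ⟨y, hy, hy'⟩ := (hacc.and_eventually this).exists
        exact hy' hy.2
    refine (hZ.image ((↑) : L → Euc n)).subset ?_
    rintro x ⟨hxB, hxL, hx⟩
    exact ⟨⟨x, hxL⟩, ⟨hxB, hΛ' _ _ hx⟩, rfl⟩
  · intro x hxB hxL hx l hl hll
    have := hinj ⟨x, hxL⟩ (hBO hxB) (hΛ' _ _ hx)
    have h0 : Ψ' ⟨x, hxL⟩ ⟨l, hl⟩ = 0 := by
      change Λ (hessian F x l) = 0
      rw [hΛ]
      simp [hll _ (b _).2]
    have := this (h0.trans (map_zero _).symm)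
    simpa using congrArg Subtype.val this

/-- For all but finitely many `b`, adding `b` times the inner product to a bilinear form makes it
nondegenerate on a given subspace. -/
theorem finite_setOf_degenerate (M : Submodule ℝ (Euc n)) (Q : Euc n →L[ℝ] Euc n →L[ℝ] ℝ) :
    {b : ℝ | ∃ m ∈ M, m ≠ 0 ∧ ∀ m' ∈ M, Q m m' + b * ⟪m, m'⟫_ℝ = 0}.Finite := by
  let e := stdOrthonormalBasis ℝ M
  -- The endomorphism representing `Q` on `M`; a degenerate `b` is the negative of one of its
  -- eigenvalues.
  let T : Module.End ℝ M :=
    ∑ i, (((ContinuousLinearMap.apply ℝ ℝ (e i : Euc n)).comp (Q.comp M.subtypeL)).smulRight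
      (e i)).toLinearMap
  have hT : ∀ m, T m = ∑ i, Q m (e i) • e i := fun m => by simp [T]
  refine ((Module.End.finite_hasEigenvalue T).image (fun μ => -μ)).subset ?_
  rintro b ⟨m, hm, hm0, h⟩
  refine ⟨-b, ?_, neg_neg b⟩
  refine Module.End.hasEigenvalue_of_hasEigenvector (x := ⟨m, hm⟩) ⟨?_, by simpa using hm0⟩
  rw [Module.End.mem_eigenspace_iff, hT]
  conv_rhs => rw [← e.sum_repr' ⟨m, hm⟩]
  rw [Finset.smul_sum]
  refine Finset.sum_congr rfl fun i _ => ?_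
  rw [smul_smul]
  congr 1
  have := h _ (e i).2
  rw [Submodule.coe_inner, real_inner_comm]
  simp only
  linarith

/-- Simultaneous tangential and normal perturbation along a subspace `L`. -/
theorem exists_nondegenerate_perturbation {L : Submodule ℝ (Euc n)} {F : Euc n → ℝ}
    {O B : Set (Euc n)} (hF : ∀ x ∈ O, ContDiffAt ℝ 2 F x) (hB : IsCompact B) (hBO : B ⊆ O)
    {t : ℝ} (ht : 0 < t) :
    ∃ a ∈ L, ‖a‖ < t ∧ ∃ b : ℝ, |b| < t ∧ ∀ x ∈ B, x ∈ L →
      (∀ l ∈ L, fderiv ℝ F x l + ⟪a, l⟫_ℝ = 0) →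
        (∀ l ∈ L, (∀ l' ∈ L, hessian F x l l' = 0) → l = 0) ∧
        ∀ m ∈ Lᗮ, (∀ m' ∈ Lᗮ, hessian F x m m' + b * ⟪m, m'⟫_ℝ = 0) → m = 0 := by
  obtain ⟨a, haL, hat, hfin, hnd⟩ := exists_regular_value (L := L) hF hB hBO ht
  -- The relevant points depend on `a` but not on `b`, so `b` has only finitely many values to avoid
  -- once `a` is fixed.
  have hbad := hfin.biUnion fun x _ => finite_setOf_degenerate Lᗮ (hessian F x)
  obtain ⟨b, hb, hb'⟩ := ((Ioo_infinite ht).sdiff hbad).nonempty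
  refine ⟨a, haL, hat, b, by rw [abs_of_pos hb.1]; exact hb.2, fun x hxB hxL hx =>
    ⟨hnd x hxB hxL hx, fun m hm hmm => ?_⟩⟩
  by_contra hm0
  exact hb' (mem_biUnion (show x ∈ _ from ⟨hxB, hxL, hx⟩) ⟨m, hm, hm0, hmm⟩)

end Sard

/-! ### Orthogonal representations, fixed subspaces and invariant Hessians. -/

section Representation

variable {n : ℕ} {Γ : Type*} [Group Γ] (ρ : Γ →* (Euc n ≃ₗᵢ[ℝ] Euc n))

theorem map_mul_apply (a b : Γ) (x : Euc n) : ρ (a * b) x = ρ a (ρ b x) := by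
  rw [map_mul]
  rfl

theorem apply_apply_inv (γ : Γ) (x : Euc n) : ρ γ (ρ γ⁻¹ x) = x := by
  rw [← map_mul_apply, mul_inv_cancel, map_one]
  rfl

theorem apply_inv_apply (γ : Γ) (x : Euc n) : ρ γ⁻¹ (ρ γ x) = x := by
  rw [← map_mul_apply, inv_mul_cancel, map_one]
  rfl

/-- The stabilizer of a point under a linear representation. -/
def isotropy (x : Euc n) : Subgroup Γ where
  carrier := {γ | ρ γ x = x}
  one_mem' := by simp
  mul_mem' := by
    intro a b (ha : ρ a x = x) (hb : ρ b x = x)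
    change ρ (a * b) x = x
    rw [map_mul_apply, hb, ha]
  inv_mem' := by
    intro a (ha : ρ a x = x)
    change ρ a⁻¹ x = x
    conv_lhs => rw [← ha]
    exact apply_inv_apply ρ a x

@[simp] theorem mem_isotropy {x : Euc n} {γ : Γ} : γ ∈ isotropy ρ x ↔ ρ γ x = x := Iff.rfl

/-- The subspace of vectors fixed by a subgroup. -/
def fixedSubspace (T : Subgroup Γ) : Submodule ℝ (Euc n) where
  carrier := {x | ∀ γ ∈ T, ρ γ x = x}
  add_mem' := by
    intro a b ha hb γ hγ
    rw [map_add, ha γ hγ, hb γ hγ]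
  zero_mem' := by simp
  smul_mem' := by
    intro c x hx γ hγ
    rw [map_smul, hx γ hγ]

variable {ρ}

theorem inner_apply_of_mem_fixedSubspace {T : Subgroup Γ} {l : Euc n}
    (hl : l ∈ fixedSubspace ρ T) {γ : Γ} (hγ : γ ∈ T) (x : Euc n) :
    ⟪l, ρ γ x⟫_ℝ = ⟪l, x⟫_ℝ := by
  conv_lhs => rw [← hl γ hγ]
  exact LinearIsometryEquiv.inner_map_map _ _ _

/-- An invariant functional vanishes on the orthogonal complement of the fixed subspace. -/
theorem invariant_functional_eq_zero {T : Subgroup Γ} {ℓ : Euc n →L[ℝ] ℝ}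
    (hℓ : ∀ γ ∈ T, ∀ w, ℓ (ρ γ w) = ℓ w) {m : Euc n} (hm : m ∈ (fixedSubspace ρ T)ᗮ) :
    ℓ m = 0 := by
  obtain ⟨a, rfl⟩ := (InnerProductSpace.toDual ℝ (Euc n)).surjective ℓ
  simp only [InnerProductSpace.toDual_apply_apply] at hℓ ⊢
  have ha : a ∈ fixedSubspace ρ T := by
    intro γ hγ
    refine ext_inner_right ℝ fun w => ?_
    rw [← hℓ γ hγ w]
    conv_lhs => rw [← apply_apply_inv ρ γ w, LinearIsometryEquiv.inner_map_map]
    rw [← hℓ γ hγ, apply_apply_inv, ← hℓ γ hγ]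
  exact hm a ha

theorem hessian_apply_of_invariant {F : Euc n → ℝ} {x : Euc n} {A : Euc n ≃ₗᵢ[ℝ] Euc n}
    (hF : ContDiffAt ℝ 2 F x) (hA : A x = x) (hinv : ∀ᶠ y in 𝓝 x, F (A y) = F y)
    (hc : fderiv ℝ F x = 0) (v w : Euc n) :
    hessian F x (A v) (A w) = hessian F x v w := by
  have hd : fderiv ℝ A x = (A : Euc n →L[ℝ] Euc n) := A.toContinuousLinearEquiv.fderiv
  have h1 : F ∘ A =ᶠ[𝓝 x] F := hinv
  have h2 := hessian_comp_of_critical (h := F) (e := A) (x := x)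
    A.contDiff.contDiffAt (by rwa [hA]) (by rwa [hA]) v w
  rw [hessian_congr h1, hA, hd] at h2
  exact h2.symm

/-- At an invariant critical point, the Hessian of an invariant function is block diagonal with
respect to the fixed subspace and its orthogonal complement. -/
theorem hessian_block {T : Subgroup Γ} {F : Euc n → ℝ} {x : Euc n}
    (hF : ContDiffAt ℝ 2 F x) (hx : x ∈ fixedSubspace ρ T)
    (hinv : ∀ γ ∈ T, ∀ᶠ y in 𝓝 x, F (ρ γ y) = F y) (hc : fderiv ℝ F x = 0)
    {l m : Euc n} (hl : l ∈ fixedSubspace ρ T) (hm : m ∈ (fixedSubspace ρ T)ᗮ) :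
    hessian F x l m = 0 ∧ hessian F x m l = 0 := by
  constructor
  · refine invariant_functional_eq_zero (ℓ := hessian F x l) (fun γ hγ w => ?_) hm
    conv_lhs => rw [← hl γ hγ]
    exact hessian_apply_of_invariant hF (hx γ hγ) (hinv γ hγ) hc l w
  · refine invariant_functional_eq_zero (ℓ := (hessian F x).flip l) (fun γ hγ w => ?_) hm
    simp only [ContinuousLinearMap.flip_apply]
    conv_lhs => rw [← hl γ hγ]
    exact hessian_apply_of_invariant hF (hx γ hγ) (hinv γ hγ) hc w l

end Representation

/-! ### Bad 2-jets and `C²` openness of being good. -/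

section Jets

variable {n : ℕ}

/-- The 2-jets of functions at the critical points that are to be avoided: the degenerate ones,
and those on the subspace `L` whose Hessian is not positive definite across `L`. -/
def badJets (L : Submodule ℝ (Euc n)) :
    Set (Euc n × (Euc n →L[ℝ] ℝ) × (Euc n →L[ℝ] Euc n →L[ℝ] ℝ)) :=
  {j | j.2.1 = 0 ∧ ((∃ v ∈ sphere (0 : Euc n) 1, j.2.2 v = 0) ∨
    (j.1 ∈ L ∧ ∃ v ∈ sphere (0 : Euc n) 1, v ∈ Lᗮ ∧ j.2.2 v v ≤ 0))}

/-- Projection along a compact factor is a closed map. This is why bad directions are normalized to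
unit length in `badJets`. -/
theorem isClosed_setOf_exists_sphere {Y : Type*} [TopologicalSpace Y]
    {C : Set (Euc n × Y)} (hC : IsClosed C) :
    IsClosed {y | ∃ v ∈ sphere (0 : Euc n) 1, (v, y) ∈ C} := by
  have : CompactSpace (sphere (0 : Euc n) 1) := isCompact_iff_compactSpace.1 (isCompact_sphere 0 1)
  have h := isClosedMap_snd_of_compactSpace (X := sphere (0 : Euc n) 1) (Y := Y)
    ((fun p => ((p.1 : Euc n), p.2)) ⁻¹' C) (hC.preimage (by fun_prop))
  convert h using 1
  ext y
  constructor
  · rintro ⟨v, hv, hvy⟩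
    exact ⟨(⟨v, hv⟩, y), hvy, rfl⟩
  · rintro ⟨p, hp, rfl⟩
    exact ⟨p.1, p.1.2, hp⟩

theorem isClosed_badJets (L : Submodule ℝ (Euc n)) : IsClosed (badJets L) := by
  have h0 : IsClosed {j : Euc n × (Euc n →L[ℝ] ℝ) × (Euc n →L[ℝ] Euc n →L[ℝ] ℝ) | j.2.1 = 0} :=
    isClosed_eq (by fun_prop) (by fun_prop)
  have h1 : IsClosed {p : Euc n × (Euc n × (Euc n →L[ℝ] ℝ) × (Euc n →L[ℝ] Euc n →L[ℝ] ℝ)) |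
      p.2.2.2 p.1 p.1 ≤ 0} := isClosed_le (by fun_prop) (by fun_prop)
  refine h0.inter (IsClosed.union ?_ ?_)
  · exact isClosed_setOf_exists_sphere
      (C := {p : Euc n × (Euc n × (Euc n →L[ℝ] ℝ) × (Euc n →L[ℝ] Euc n →L[ℝ] ℝ)) |
        p.2.2.2 p.1 = 0}) (isClosed_eq (by fun_prop) (by fun_prop))
  · refine IsClosed.inter (L.closed_of_finiteDimensional.preimage continuous_fst) ?_
    exact isClosed_setOf_exists_sphere
      (C := {p : Euc n × (Euc n × (Euc n →L[ℝ] ℝ) × (Euc n →L[ℝ] Euc n →L[ℝ] ℝ)) |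
        p.1 ∈ Lᗮ ∧ p.2.2.2 p.1 p.1 ≤ 0})
      ((Lᗮ.closed_of_finiteDimensional.preimage continuous_fst).inter h1)

/-- The 2-jet of `F` at `x`, without the value. -/
noncomputable def jet (F : Euc n → ℝ) (x : Euc n) :
    Euc n × (Euc n →L[ℝ] ℝ) × (Euc n →L[ℝ] Euc n →L[ℝ] ℝ) :=
  (x, fderiv ℝ F x, hessian F x)

/-- The critical points of `F` in `S` are nondegenerate, and those on `L` have a Hessian that is
positive definite on the orthogonal complement of `L`. -/
def GoodOn (L : Submodule ℝ (Euc n)) (F : Euc n → ℝ) (S : Set (Euc n)) : Prop :=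
  ∀ x ∈ S, jet F x ∉ badJets L

theorem GoodOn.mono {L : Submodule ℝ (Euc n)} {F : Euc n → ℝ} {S S' : Set (Euc n)}
    (h : GoodOn L F S) (hS : S' ⊆ S) : GoodOn L F S' := fun x hx => h x (hS hx)

theorem goodOn_union {L : Submodule ℝ (Euc n)} {F : Euc n → ℝ} {S S' : Set (Euc n)} :
    GoodOn L F (S ∪ S') ↔ GoodOn L F S ∧ GoodOn L F S' :=
  ⟨fun h => ⟨h.mono subset_union_left, h.mono subset_union_right⟩,
    fun h x hx => hx.elim (h.1 x) (h.2 x)⟩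

theorem continuousAt_jet {F : Euc n → ℝ} {x : Euc n} (hF : ContDiffAt ℝ 2 F x) :
    ContinuousAt (jet F) x := by
  have h1 : ContDiffAt ℝ 1 (fderiv ℝ F) x := hF.fderiv_right (by norm_num)
  have h2 : ContDiffAt ℝ 0 (fderiv ℝ (fderiv ℝ F)) x := h1.fderiv_right (by norm_num)
  exact continuousAt_id.prodMk (h1.continuousAt.prodMk h2.continuousAt)

theorem isCompact_setOf_bad {L : Submodule ℝ (Euc n)} {F : Euc n → ℝ} {S : Set (Euc n)}
    (hS : IsCompact S) (hF : ∀ x ∈ S, ContDiffAt ℝ 2 F x) :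
    IsCompact {x | x ∈ S ∧ jet F x ∈ badJets L} := by
  have hc : ContinuousOn (jet F) S := fun x hx => (continuousAt_jet (hF x hx)).continuousWithinAt
  exact hS.of_isClosed_subset (hc.preimage_isClosed_of_isClosed hS.isClosed (isClosed_badJets L))
    fun x hx => hx.1

theorem exists_pos_forall_dist_ge {α : Type*} [PseudoMetricSpace α] {s t : Set α}
    (hst : Disjoint s t) (hs : IsCompact s) (ht : IsClosed t) :
    ∃ δ > 0, ∀ x ∈ s, ∀ y ∈ t, δ ≤ dist y x := by
  obtain ⟨δ, hδ, hd⟩ := hst.exists_thickenings hs ht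
  refine ⟨δ, hδ, fun x hx y hy => ?_⟩
  by_contra! hlt
  exact Set.disjoint_left.1 hd (mem_thickening_iff.2 ⟨x, hx, hlt⟩) (self_subset_thickening hδ _ hy)

/-- Being good on a compact set is an open condition in the `C²` topology. -/
theorem GoodOn.exists_pos {L : Submodule ℝ (Euc n)} {F : Euc n → ℝ} {S : Set (Euc n)}
    (hS : IsCompact S) (hF : ∀ x ∈ S, ContDiffAt ℝ 2 F x) (h : GoodOn L F S) :
    ∃ δ > 0, ∀ u : Euc n → ℝ, ContDiff ℝ ∞ u →
      (∀ x, ‖fderiv ℝ u x‖ < δ ∧ ‖hessian u x‖ < δ) → GoodOn L (F + u) S := by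
  have hc : ContinuousOn (jet F) S := fun x hx => (continuousAt_jet (hF x hx)).continuousWithinAt
  -- The jets over `S` form a compact set disjoint from a closed one; the distance between them is
  -- the permitted size of the perturbation.
  have hdisj : Disjoint (jet F '' S) (badJets L) := by
    rw [Set.disjoint_left]
    rintro _ ⟨x, hx, rfl⟩
    exact h x hx
  obtain ⟨δ, hδ, hd⟩ :=
    exists_pos_forall_dist_ge hdisj (hS.image_of_continuousOn hc) (isClosed_badJets L)
  refine ⟨δ, hδ, fun u hu hsmall x hx hbad => ?_⟩
  have hu2 : ContDiffAt ℝ 2 u x := hu.contDiffAt.of_le (two_le_coe le_top)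
  refine (hd _ (mem_image_of_mem _ hx) _ hbad).not_gt ?_
  have h1 : jet (F + u) x = (x, fderiv ℝ F x + fderiv ℝ u x, hessian F x + hessian u x) := by
    rw [← hessian_add (hF x hx) hu2, ← (fderiv_add_eventuallyEq (hF x hx) hu2).eq_of_nhds]
    rfl
  rw [h1, jet, Prod.dist_eq, Prod.dist_eq, dist_self]
  refine max_lt hδ (max_lt ?_ ?_)
  · exact (dist_self_add_left _ _).trans_lt (hsmall x).1
  · have h2 : dist (hessian F x + hessian u x) (hessian F x) = ‖hessian u x‖ :=
      dist_self_add_left (E := Euc n →L[ℝ] Euc n →L[ℝ] ℝ) _ _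
    exact h2.trans_lt (hsmall x).2

end Jets

/-! ### Uniform bounds on derivatives up to order two. -/

section Bounds

variable {n : ℕ}

/-- `u` is smooth and its derivatives up to order two are bounded by `C`. -/
def C2Le (C : ℝ) (u : Euc n → ℝ) : Prop :=
  ContDiff ℝ ∞ u ∧ ∀ x, ‖u x‖ ≤ C ∧ ‖fderiv ℝ u x‖ ≤ C ∧ ‖hessian u x‖ ≤ C

theorem ContDiff.contDiffAt_two_of_smooth {u : Euc n → ℝ} (hu : ContDiff ℝ ∞ u) (x : Euc n) :
    ContDiffAt ℝ 2 u x :=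
  hu.contDiffAt.of_le (two_le_coe le_top)

theorem exists_c2Le {u : Euc n → ℝ} (hu : ContDiff ℝ ∞ u) (hs : HasCompactSupport u) :
    ∃ C, C2Le C u := by
  have hu1 : ContDiff ℝ ∞ (fderiv ℝ u) := hu.fderiv_right (by simp)
  have hu2 : ContDiff ℝ ∞ (hessian u) := hu1.fderiv_right (by simp)
  obtain ⟨C₀, h₀⟩ := hu.continuous.bounded_above_of_compact_support hs
  obtain ⟨C₁, h₁⟩ := hu1.continuous.bounded_above_of_compact_support (hs.fderiv ℝ)
  obtain ⟨C₂, h₂⟩ : ∃ C, ∀ x, ‖hessian u x‖ ≤ C :=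
    Continuous.bounded_above_of_compact_support (E := Euc n →L[ℝ] Euc n →L[ℝ] ℝ)
      hu2.continuous ((hs.fderiv ℝ).fderiv ℝ)
  refine ⟨max C₀ (max C₁ C₂), hu, fun x => ⟨?_, ?_, ?_⟩⟩
  · exact (h₀ x).trans (le_max_left _ _)
  · exact (h₁ x).trans ((le_max_left _ _).trans (le_max_right _ _))
  · exact (h₂ x).trans ((le_max_right _ _).trans (le_max_right _ _))

theorem C2Le.add {C D : ℝ} {u v : Euc n → ℝ} (hu : C2Le C u) (hv : C2Le D v) :
    C2Le (C + D) (u + v) := by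
  refine ⟨hu.1.add hv.1, fun x => ⟨?_, ?_, ?_⟩⟩
  · exact norm_add_le_of_le (hu.2 x).1 (hv.2 x).1
  · rw [fderiv_add (hu.1.differentiable (by simp) x) (hv.1.differentiable (by simp) x)]
    exact norm_add_le_of_le (hu.2 x).2.1 (hv.2 x).2.1
  · rw [hessian_add (hu.1.contDiffAt_two_of_smooth x) (hv.1.contDiffAt_two_of_smooth x)]
    exact (norm_add_le (hessian u x) (hessian v x)).trans
      (add_le_add (hu.2 x).2.2 (hv.2 x).2.2)

theorem fderiv_smul_eq {u : Euc n → ℝ} (hu : ContDiff ℝ ∞ u) (s : ℝ) :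
    fderiv ℝ (s • u) = s • fderiv ℝ u := by
  funext x
  exact fderiv_const_smul (hu.differentiable (by simp) x) s

theorem hessian_smul {u : Euc n → ℝ} (hu : ContDiff ℝ ∞ u) (s : ℝ) (x : Euc n) :
    hessian (s • u) x = s • hessian u x := by
  unfold hessian
  rw [fderiv_smul_eq hu]
  exact fderiv_const_smul ((hu.fderiv_right (m := ∞) (by simp)).differentiable (by simp) x) s

theorem C2Le.smul {C : ℝ} {u : Euc n → ℝ} (hu : C2Le C u) (s : ℝ) :
    C2Le (|s| * C) (s • u) := by
  have key : ∀ {r : ℝ}, r ≤ C → |s| * r ≤ |s| * C := fun h =>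
    mul_le_mul_of_nonneg_left h (abs_nonneg s)
  refine ⟨hu.1.const_smul s, fun x => ⟨?_, ?_, ?_⟩⟩
  · rw [Pi.smul_apply, norm_smul, Real.norm_eq_abs]
    exact key (hu.2 x).1
  · rw [fderiv_smul_eq hu.1, Pi.smul_apply, norm_smul, Real.norm_eq_abs]
    exact key (hu.2 x).2.1
  · rw [hessian_smul hu.1]
    exact (ContinuousLinearMap.opNorm_smul_le s (hessian u x)).trans (key (hu.2 x).2.2)

theorem C2Le.sum {ι : Type*} {C : ι → ℝ} {u : ι → Euc n → ℝ} (s : Finset ι)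
    (hu : ∀ i, C2Le (C i) (u i)) : C2Le (∑ i ∈ s, C i) (∑ i ∈ s, u i) := by
  classical
  induction s using Finset.induction_on with
  | empty =>
    refine ⟨contDiff_const, fun x => ⟨by simp, by simp, ?_⟩⟩
    have h0 : hessian (0 : Euc n → ℝ) x = 0 := by simp [hessian]
    rw [Finset.sum_empty, Finset.sum_empty, h0]
    exact ContinuousLinearMap.opNorm_zero.le
  | insert i s hi ih =>
    rw [Finset.sum_insert hi, Finset.sum_insert hi]
    exact (hu i).add ih

/-- Small linear combinations of finitely many smooth compactly supported functions are `C²`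
small. -/
theorem exists_pos_small_combination {ι : Type*} [Fintype ι] {u : ι → Euc n → ℝ}
    (hu : ∀ i, ContDiff ℝ ∞ (u i)) (hs : ∀ i, HasCompactSupport (u i)) {δ : ℝ} (hδ : 0 < δ) :
    ∃ t > 0, ∀ s : ι → ℝ, (∀ i, |s i| < t) → ∀ x, |(∑ i, s i • u i) x| < δ ∧
      ‖fderiv ℝ (∑ i, s i • u i) x‖ < δ ∧ ‖hessian (∑ i, s i • u i) x‖ < δ := by
  choose C hC using fun i => exists_c2Le (hu i) (hs i)
  have hC0 : ∀ i, 0 ≤ C i := fun i => (norm_nonneg _).trans ((hC i).2 0).1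
  have hpos : 0 < ∑ i, C i + 1 := by
    have := Finset.sum_nonneg (s := Finset.univ) fun i _ => hC0 i
    linarith
  refine ⟨δ / (∑ i, C i + 1), by positivity, fun s hs x => ?_⟩
  have h := (C2Le.sum Finset.univ fun i => (hC i).smul (s i)).2 x
  have hlt : ∑ i, |s i| * C i < δ := by
    calc ∑ i, |s i| * C i ≤ ∑ i, δ / (∑ i, C i + 1) * C i :=
          Finset.sum_le_sum fun i _ => mul_le_mul_of_nonneg_right (hs i).le (hC0 i)
      _ = δ / (∑ i, C i + 1) * ∑ i, C i := by rw [Finset.mul_sum]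
      _ < δ / (∑ i, C i + 1) * (∑ i, C i + 1) := by
          apply mul_lt_mul_of_pos_left _ (by positivity)
          linarith
      _ = δ := by field_simp
  exact ⟨h.1.trans_lt hlt, h.2.1.trans_lt hlt, h.2.2.trans_lt hlt⟩

end Bounds

/-! ### The model perturbation: a linear term plus a normal quadratic term. -/

section Model

variable {n : ℕ}

/-- A linear function plus a multiple of the squared distance to the subspace `L`. -/
noncomputable def model (L : Submodule ℝ (Euc n)) (a : Euc n) (b : ℝ) (x : Euc n) : ℝ :=
  ⟪a, x⟫_ℝ + b * (2⁻¹ * ⟪Lᗮ.starProjection x, x⟫_ℝ)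

theorem contDiff_model (L : Submodule ℝ (Euc n)) (a : Euc n) (b : ℝ) :
    ContDiff ℝ ∞ (model L a b) := by
  have h1 : ContDiff ℝ ∞ fun x : Euc n => ⟪a, x⟫_ℝ := contDiff_const.inner ℝ contDiff_id
  have h2 : ContDiff ℝ ∞ fun x : Euc n => ⟪Lᗮ.starProjection x, x⟫_ℝ :=
    Lᗮ.starProjection.contDiff.inner ℝ contDiff_id
  exact h1.add (contDiff_const.mul (contDiff_const.mul h2))

theorem fderiv_model (L : Submodule ℝ (Euc n)) (a : Euc n) (b : ℝ) :
    fderiv ℝ (model L a b) = fun x => innerSL ℝ a + b • (innerSL ℝ).comp Lᗮ.starProjection x := by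
  funext x
  have h1 : HasFDerivAt (fun x : Euc n => ⟪Lᗮ.starProjection x, x⟫_ℝ) _ x :=
    Lᗮ.starProjection.hasFDerivAt.inner ℝ (hasFDerivAt_id x)
  have h2 : HasFDerivAt (fun x : Euc n => ⟪a, x⟫_ℝ) (innerSL ℝ a) x := (innerSL ℝ a).hasFDerivAt
  have h3 := (h2.add ((h1.const_mul (2⁻¹ : ℝ)).const_mul b)).fderiv
  refine h3.trans ?_
  ext v
  have : ⟪Lᗮ.starProjection v, x⟫_ℝ = ⟪Lᗮ.starProjection x, v⟫_ℝ := by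
    rw [Submodule.inner_starProjection_left_eq_right, real_inner_comm]
  change ⟪a, v⟫_ℝ + b * (2⁻¹ * (⟪Lᗮ.starProjection x, v⟫_ℝ + ⟪Lᗮ.starProjection v, x⟫_ℝ)) =
    ⟪a, v⟫_ℝ + b * ⟪Lᗮ.starProjection x, v⟫_ℝ
  rw [this]
  ring

theorem hessian_model (L : Submodule ℝ (Euc n)) (a : Euc n) (b : ℝ) (x v w : Euc n) :
    hessian (model L a b) x v w = b * ⟪Lᗮ.starProjection v, w⟫_ℝ := by
  unfold hessian
  rw [fderiv_model]
  have h : HasFDerivAt (fun x => innerSL ℝ a + b • (innerSL ℝ).comp Lᗮ.starProjection x)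
      (b • (innerSL ℝ).comp Lᗮ.starProjection : Euc n →L[ℝ] Euc n →L[ℝ] ℝ) x :=
    (((innerSL ℝ).comp Lᗮ.starProjection :
      Euc n →L[ℝ] Euc n →L[ℝ] ℝ).hasFDerivAt.const_smul b).const_add _
  rw [h.fderiv]
  rfl

end Model

/-! ### Invariant functions with small support, and symmetrization. -/

section Admissible

variable {n : ℕ} {Γ : Type*} [Group Γ] (ρ : Γ →* (Euc n ≃ₗᵢ[ℝ] Euc n))

/-- The smooth invariant functions with support inside the open ball of radius `η`. -/
def admissible (η : ℝ) : Submodule ℝ (Euc n → ℝ) where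
  carrier := {u | ContDiff ℝ ∞ u ∧ (∀ γ x, u (ρ γ x) = u x) ∧ tsupport u ⊆ ball 0 η}
  add_mem' := by
    rintro u v ⟨hu, hui, hus⟩ ⟨hv, hvi, hvs⟩
    exact ⟨hu.add hv, fun γ x => by simp [hui, hvi],
      (tsupport_add u v).trans (union_subset hus hvs)⟩
  zero_mem' := ⟨contDiff_const, fun _ _ => rfl, by simp⟩
  smul_mem' := by
    rintro c u ⟨hu, hui, hus⟩
    refine ⟨hu.const_smul c, fun γ x => by simp [hui], ?_⟩
    exact (closure_mono (Function.support_const_smul_subset c u)).trans hus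

variable {ρ}

/-- `T` moves a point only orthogonally to its fixed subspace, so the projection to that subspace is
unchanged; the norm is preserved, hence so is the distance to the subspace. -/
theorem model_invariant {T : Subgroup Γ} {a : Euc n} (ha : a ∈ fixedSubspace ρ T) (b : ℝ)
    {γ : Γ} (hγ : γ ∈ T) (x : Euc n) :
    model (fixedSubspace ρ T) a b (ρ γ x) = model (fixedSubspace ρ T) a b x := by
  set L := fixedSubspace ρ T
  have hπ : L.starProjection (ρ γ x) = L.starProjection x := by
    have : ρ γ x - x ∈ Lᗮ := fun l hl => by
      rw [inner_sub_right, inner_apply_of_mem_fixedSubspace hl hγ, sub_self]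
    rw [← sub_eq_zero, ← map_sub, Submodule.starProjection_apply_eq_zero_iff]
    exact this
  have hP : ∀ y, ⟪Lᗮ.starProjection y, y⟫_ℝ = ‖y‖ ^ 2 - ⟪L.starProjection y, y⟫_ℝ := fun y => by
    rw [Submodule.starProjection_orthogonal_val, inner_sub_left, real_inner_self_eq_norm_sq]
  unfold model
  rw [inner_apply_of_mem_fixedSubspace ha hγ, hP, hP, hπ, LinearIsometryEquiv.norm_map,
    inner_apply_of_mem_fixedSubspace (L.starProjection_apply_mem x) hγ]

theorem hasCompactSupport_of_tsupport_subset {u : Euc n → ℝ} {c : Euc n} {η : ℝ}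
    (h : tsupport u ⊆ ball c η) : HasCompactSupport u :=
  (isCompact_closedBall c η).of_isClosed_subset (isClosed_tsupport u) (h.trans ball_subset_closedBall)

variable [Fintype Γ] (ρ)

/-- The sum of the translates of `w`. -/
noncomputable def symmetrize (w : Euc n → ℝ) (x : Euc n) : ℝ := ∑ γ, w (ρ γ x)

variable {ρ}

theorem symmetrize_mem_admissible {w : Euc n → ℝ} {η : ℝ} (hw : ContDiff ℝ ∞ w)
    (hs : tsupport w ⊆ ball 0 η) : symmetrize ρ w ∈ admissible ρ η := by
  refine ⟨?_, ?_, ?_⟩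
  · unfold symmetrize
    exact ContDiff.sum fun γ _ => hw.comp (ρ γ).contDiff
  · intro γ x
    unfold symmetrize
    simp_rw [← map_mul_apply ρ]
    exact Fintype.sum_equiv (Equiv.mulRight γ) _ _ fun _ => rfl
  · have h1 : Function.support (symmetrize ρ w) ⊆ ⋃ γ, (ρ γ) ⁻¹' tsupport w := by
      intro x hx
      by_contra hx'
      simp only [mem_iUnion, mem_preimage, not_exists] at hx'
      exact hx (Finset.sum_eq_zero fun γ _ => image_eq_zero_of_notMem_tsupport (hx' γ))
    have h2 : IsClosed (⋃ γ, (ρ γ) ⁻¹' tsupport w) :=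
      isClosed_iUnion_of_finite fun γ => (isClosed_tsupport w).preimage (ρ γ).continuous
    refine (closure_minimal h1 h2).trans (iUnion_subset fun γ x hx => ?_)
    have := hs hx
    simpa using this

/-- Near a point, the symmetrization of a function with small support is a multiple of the
function, if the latter is invariant under the stabilizer. -/
theorem symmetrize_eq_of_mem_ball {w m : Euc n → ℝ} {c x : Euc n} {r : ℝ}
    (hsep : ∀ γ ∉ isotropy ρ c, 4 * r ≤ dist (ρ γ c) c)
    (hsupp : ∀ y ∉ ball c (2 * r), w y = 0) (hw : ∀ y ∈ ball c r, w y = m y)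
    (hm : ∀ γ ∈ isotropy ρ c, ∀ y, m (ρ γ y) = m y) (hx : x ∈ ball c r) :
    symmetrize ρ w x = Nat.card (isotropy ρ c) • m x := by
  classical
  have hr : 0 < r := pos_of_mem_ball hx
  have h1 : ∀ γ, w (ρ γ x) = if γ ∈ isotropy ρ c then m x else 0 := by
    intro γ
    have hd : dist (ρ γ x) (ρ γ c) < r := by rwa [LinearIsometryEquiv.dist_map]
    split_ifs with hγ
    · have hγ' : ρ γ c = c := hγ
      rw [hw _ (by rwa [hγ'] at hd), hm γ hγ]
    -- Here `ρ γ x` is within `r` of `ρ γ c`, which is at least `4 r` from `c`; so it lies outside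
    -- the ball of radius `2 r`.
    · apply hsupp
      intro h
      have h3 := hsep γ hγ
      have h4 := dist_triangle_left (ρ γ c) c (ρ γ x)
      rw [mem_ball] at h
      linarith
  unfold symmetrize
  simp_rw [h1]
  rw [Finset.sum_ite, Finset.sum_const, Finset.sum_const_zero, add_zero,
    Nat.card_eq_fintype_card, Fintype.card_subtype]

end Admissible

/-! ### Removing degenerate critical points near one point. -/

section Perturbation

variable {n : ℕ} {Γ : Type*} [Group Γ] {ρ : Γ →* (Euc n ≃ₗᵢ[ℝ] Euc n)}

/-- The bump function at `c` that is `1` on the ball of radius `r` and vanishes off the ball of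
radius `2 r`. -/
def bump (c : Euc n) {r : ℝ} (hr : 0 < r) : ContDiffBump c :=
  ⟨r, 2 * r, hr, by linarith⟩

theorem bump_eq_one {c y : Euc n} {r : ℝ} (hr : 0 < r) (hy : y ∈ ball c r) : bump c hr y = 1 :=
  (bump c hr).one_of_mem_closedBall (ball_subset_closedBall hy)

theorem bump_eq_zero {c y : Euc n} {r : ℝ} (hr : 0 < r) (hy : y ∉ ball c (2 * r)) :
    bump c hr y = 0 :=
  (bump c hr).zero_of_le_dist (not_lt.1 hy)

variable [Fintype Γ] (ρ)

/-- The symmetrization of the model function, cut off near `c`. -/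
noncomputable def cutModel (c : Euc n) {r : ℝ} (hr : 0 < r) (a : Euc n) (b : ℝ) : Euc n → ℝ :=
  symmetrize ρ fun y => bump c hr y * model (fixedSubspace ρ (isotropy ρ c)) a b y

variable {ρ}

theorem cutModel_mem_admissible {c : Euc n} {r η : ℝ} (hr : 0 < r)
    (hball : closedBall c (2 * r) ⊆ ball 0 η) (a : Euc n) (b : ℝ) :
    cutModel ρ c hr a b ∈ admissible ρ η := by
  refine symmetrize_mem_admissible ((bump c hr).contDiff.mul (contDiff_model _ _ _)) ?_
  refine (tsupport_mul_subset_left (f := bump c hr)).trans ?_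
  rw [ContDiffBump.tsupport_eq]
  exact hball

theorem cutModel_eq {c : Euc n} {r : ℝ} (hr : 0 < r)
    (hsep : ∀ γ ∉ isotropy ρ c, 4 * r ≤ dist (ρ γ c) c)
    {a : Euc n} (ha : a ∈ fixedSubspace ρ (isotropy ρ c)) (b : ℝ) {x : Euc n}
    (hx : x ∈ ball c r) :
    cutModel ρ c hr a b x = ((Nat.card (isotropy ρ c) : ℝ) •
      model (fixedSubspace ρ (isotropy ρ c)) a b) x := by
  rw [Pi.smul_apply, Nat.cast_smul_eq_nsmul]
  refine symmetrize_eq_of_mem_ball hsep (fun y hy => ?_) (fun y hy => ?_)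
    (fun γ hγ y => model_invariant ha b hγ y) hx
  · rw [bump_eq_zero hr hy, zero_mul]
  · rw [bump_eq_one hr hy, one_mul]

theorem fderiv_cutModel {c : Euc n} {r : ℝ} (hr : 0 < r)
    (hsep : ∀ γ ∉ isotropy ρ c, 4 * r ≤ dist (ρ γ c) c)
    {a : Euc n} (ha : a ∈ fixedSubspace ρ (isotropy ρ c)) (b : ℝ) {x : Euc n}
    (hx : x ∈ ball c r) (v : Euc n) :
    fderiv ℝ (cutModel ρ c hr a b) x v = Nat.card (isotropy ρ c) *
      (⟪a, v⟫_ℝ + b * ⟪(fixedSubspace ρ (isotropy ρ c))ᗮ.starProjection x, v⟫_ℝ) := by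
  have h : cutModel ρ c hr a b =ᶠ[𝓝 x] _ :=
    eventually_of_mem (isOpen_ball.mem_nhds hx) fun y hy => cutModel_eq hr hsep ha b hy
  rw [h.fderiv_eq, fderiv_smul_eq (contDiff_model _ _ _), fderiv_model]
  rfl

theorem hessian_cutModel {c : Euc n} {r : ℝ} (hr : 0 < r)
    (hsep : ∀ γ ∉ isotropy ρ c, 4 * r ≤ dist (ρ γ c) c)
    {a : Euc n} (ha : a ∈ fixedSubspace ρ (isotropy ρ c)) (b : ℝ) {x : Euc n}
    (hx : x ∈ ball c r) (v w : Euc n) :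
    hessian (cutModel ρ c hr a b) x v w = Nat.card (isotropy ρ c) *
      (b * ⟪(fixedSubspace ρ (isotropy ρ c))ᗮ.starProjection v, w⟫_ℝ) := by
  have h : cutModel ρ c hr a b =ᶠ[𝓝 x] _ :=
    eventually_of_mem (isOpen_ball.mem_nhds hx) fun y hy => cutModel_eq hr hsep ha b hy
  rw [hessian_congr h, hessian_smul (contDiff_model _ _ _), ← hessian_model _ a b x v w]
  rfl

/-- The cut-off model is linear in `(a, b)`. Writing it in finitely many fixed functions reduces
`C²` smallness to smallness of the parameters; the index `none` carries the quadratic term. -/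
theorem cutModel_eq_sum {c : Euc n} {r : ℝ} (hr : 0 < r) (a : Euc n) (b : ℝ) :
    cutModel ρ c hr a b = ∑ o : Option (Fin n), (o.elim b fun i => a i) •
      cutModel ρ c hr (o.elim 0 fun i => EuclideanSpace.single i 1) (o.elim 1 fun _ => 0) := by
  funext x
  have key : ∀ y : Euc n, bump c hr y * model (fixedSubspace ρ (isotropy ρ c)) a b y =
      ∑ o : Option (Fin n), (o.elim b fun i => a i) * (bump c hr y *
        model (fixedSubspace ρ (isotropy ρ c)) (o.elim 0 fun i => EuclideanSpace.single i 1)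
          (o.elim 1 fun _ => 0) y) := by
    intro y
    have ha : ⟪a, y⟫_ℝ = ∑ i, a i * y i := by
      simp [PiLp.inner_apply, mul_comm]
    rw [Fintype.sum_option]
    simp only [model, Option.elim, ha, inner_zero_left, EuclideanSpace.inner_single_left]
    rw [mul_add, Finset.mul_sum, add_comm]
    congr 1
    · ring
    · refine Finset.sum_congr rfl fun i _ => ?_
      simp
      ring
  simp only [Finset.sum_apply, Pi.smul_apply, cutModel, symmetrize, smul_eq_mul, Finset.mul_sum]
  rw [Finset.sum_comm]
  exact Finset.sum_congr rfl fun γ _ => key _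

theorem exists_pos_cutModel_small {c : Euc n} {r η δ : ℝ} (hr : 0 < r)
    (hball : closedBall c (2 * r) ⊆ ball 0 η) (hδ : 0 < δ) :
    ∃ t > 0, ∀ a b, ‖a‖ < t → |b| < t → ∀ x, |cutModel ρ c hr a b x| < δ ∧
      ‖fderiv ℝ (cutModel ρ c hr a b) x‖ < δ ∧ ‖hessian (cutModel ρ c hr a b) x‖ < δ := by
  have hadm := fun o : Option (Fin n) => cutModel_mem_admissible (ρ := ρ) hr hball
    (o.elim 0 fun i => EuclideanSpace.single i 1) (o.elim 1 fun _ => 0)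
  obtain ⟨t, ht, h⟩ := exists_pos_small_combination (fun o => (hadm o).1)
    (fun o => hasCompactSupport_of_tsupport_subset (hadm o).2.2) hδ
  refine ⟨t, ht, fun a b ha hb => ?_⟩
  rw [cutModel_eq_sum]
  refine h _ fun o => ?_
  cases o with
  | none => exact hb
  | some i => exact (PiLp.norm_apply_le a i).trans_lt ha

theorem add_starProjection_orthogonal (L : Submodule ℝ (Euc n)) (v : Euc n) :
    L.starProjection v + Lᗮ.starProjection v = v :=
  L.starProjection_add_starProjection_orthogonal v

/-- Perturbation near a point: the critical points with the same stabilizer as `c` close to `c`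
can be made nondegenerate. -/
theorem exists_local_perturbation {r η δ : ℝ} {F : Euc n → ℝ} {c : Euc n} {S : Set (Euc n)}
    (hr : 0 < r) (hball : closedBall c (2 * r) ⊆ ball 0 η)
    (hsep : ∀ γ ∉ isotropy ρ c, 4 * r ≤ dist (ρ γ c) c) (hT : isotropy ρ c ≠ ⊤)
    (hF : ∀ x ∈ closedBall 0 η, ContDiffAt ℝ 2 F x)
    (hinv : ∀ γ, ∀ x ∈ ball 0 η, F (ρ γ x) = F x)
    (hS : IsCompact S) (hSη : S ⊆ closedBall 0 η)
    (hgood : GoodOn (fixedSubspace ρ ⊤) F S) (hδ : 0 < δ) :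
    ∃ u ∈ admissible ρ η, (∀ x, |u x| < δ) ∧ GoodOn (fixedSubspace ρ ⊤) (F + u)
      (S ∪ (closedBall c (r / 2) ∩ fixedSubspace ρ (isotropy ρ c))) := by
  set T := isotropy ρ c
  set L := fixedSubspace ρ T
  set N : ℝ := (Nat.card T : ℝ)
  have hN : 1 ≤ N := Nat.one_le_cast.2 Nat.card_pos
  have hN0 : 0 < N := by linarith
  obtain ⟨δ', hδ', hopen⟩ := hgood.exists_pos hS fun x hx => hF x (hSη hx)
  obtain ⟨t, ht, hsmall⟩ := exists_pos_cutModel_small (ρ := ρ) hr hball (lt_min hδ hδ')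
  have hrη : ball c r ⊆ ball 0 η := (ball_subset_closedBall.trans
    (closedBall_subset_closedBall (by linarith))).trans hball
  obtain ⟨a, haL, hat, b, hbt, hab⟩ := exists_nondegenerate_perturbation (L := L)
    (fun x hx => hF x (ball_subset_closedBall (hrη hx))) (isCompact_closedBall c (r / 2))
    (closedBall_subset_ball (by linarith : r / 2 < r)) ht
  have hNinv : N⁻¹ ≤ 1 := inv_le_one_of_one_le₀ hN
  -- Symmetrization multiplies the model by the order `N` of the isotropy group near `c`; dividing
  -- the parameters by `N` makes the effective ones `a` and `b`.
  have haL' : N⁻¹ • a ∈ L := L.smul_mem _ haL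
  have hat' : ‖N⁻¹ • a‖ < t := by
    rw [norm_smul, Real.norm_of_nonneg (by positivity)]
    exact (mul_le_of_le_one_left (norm_nonneg a) hNinv).trans_lt hat
  have hbt' : |N⁻¹ * b| < t := by
    rw [abs_mul, abs_of_pos (inv_pos.2 hN0)]
    exact (mul_le_of_le_one_left (abs_nonneg b) hNinv).trans_lt hbt
  have hs := hsmall _ _ hat' hbt'
  set u := cutModel ρ c hr (N⁻¹ • a) (N⁻¹ * b)
  have hu : u ∈ admissible ρ η := cutModel_mem_admissible hr hball _ _
  refine ⟨u, hu, fun x => (hs x).1.trans_le (min_le_left _ _), ?_⟩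
  rw [goodOn_union]
  refine ⟨hopen u hu.1 fun x => ⟨(hs x).2.1.trans_le (min_le_right _ _),
    (hs x).2.2.trans_le (min_le_right _ _)⟩, ?_⟩
  rintro x ⟨hxB, hxL⟩ ⟨hc, hbad⟩
  have hxr : x ∈ ball c r := closedBall_subset_ball (by linarith : r / 2 < r) hxB
  have hxη : x ∈ ball 0 η := hrη hxr
  have hF2 : ContDiffAt ℝ 2 F x := hF x (ball_subset_closedBall hxη)
  have hu2 : ContDiffAt ℝ 2 u x := hu.1.contDiffAt_two_of_smooth x
  have hc' : fderiv ℝ (F + u) x = 0 := hc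
  have hfd : ∀ v, fderiv ℝ (F + u) x v =
      fderiv ℝ F x v + (⟪a, v⟫_ℝ + b * ⟪Lᗮ.starProjection x, v⟫_ℝ) := fun v => by
    rw [(fderiv_add_eventuallyEq hF2 hu2).eq_of_nhds, add_apply,
      fderiv_cutModel hr hsep haL' _ hxr, real_inner_smul_left]
    change _ + N * (_ + _ * ⟪Lᗮ.starProjection x, v⟫_ℝ) = _
    linear_combination (⟪a, v⟫_ℝ + b * ⟪Lᗮ.starProjection x, v⟫_ℝ) * mul_inv_cancel₀ hN0.ne'
  have hhd : ∀ v w, hessian (F + u) x v w =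
      hessian F x v w + b * ⟪Lᗮ.starProjection v, w⟫_ℝ := fun v w => by
    rw [hessian_add hF2 hu2, add_apply, add_apply, hessian_cutModel hr hsep haL' _ hxr]
    change _ + N * (_ * ⟪Lᗮ.starProjection v, w⟫_ℝ) = _
    linear_combination (b * ⟪Lᗮ.starProjection v, w⟫_ℝ) * mul_inv_cancel₀ hN0.ne'
  have hxP : Lᗮ.starProjection x = 0 := by
    rw [Submodule.starProjection_apply_eq_zero_iff]
    exact L.le_orthogonal_orthogonal hxL
  have hcr : ∀ l ∈ L, fderiv ℝ F x l + ⟪a, l⟫_ℝ = 0 := fun l _ => by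
    have := hfd l
    rw [hc', hxP, inner_zero_left, mul_zero, add_zero] at this
    exact this.symm
  obtain ⟨htan, hnor⟩ := hab x hxB hxL hcr
  have hxinv : ∀ γ ∈ T, ∀ᶠ y in 𝓝 x, (F + u) (ρ γ y) = (F + u) y := fun γ _ => by
    filter_upwards [isOpen_ball.mem_nhds hxη] with y hy
    rw [Pi.add_apply, Pi.add_apply, hinv γ y hy, hu.2.1 γ y]
  have hblock := fun {l m : Euc n} (hl : l ∈ L) (hm : m ∈ Lᗮ) =>
    hessian_block (F := F + u) (hF2.add hu2) hxL hxinv hc' hl hm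
  rcases hbad with ⟨v, hv1, hv⟩ | ⟨hxG, -⟩
  -- Block diagonality splits a kernel vector into a tangential and a normal kernel vector. The
  -- choice of `a` kills the first, that of `b` the second.
  · have hv' : ∀ w, hessian (F + u) x v w = 0 := fun w => congrArg (fun ℓ => ℓ w) hv
    have hvd := add_starProjection_orthogonal L v
    set l := L.starProjection v
    set m := Lᗮ.starProjection v
    have hlL : l ∈ L := L.starProjection_apply_mem v
    have hmL : m ∈ Lᗮ := Lᗮ.starProjection_apply_mem v
    have hl0 : l = 0 := by
      refine htan l hlL fun l' hl' => ?_
      have h1 := hv' l'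
      rw [← hvd, map_add, add_apply, (hblock hl' hmL).2, add_zero, hhd] at h1
      have h2 : Lᗮ.starProjection l = 0 := by
        rw [Submodule.starProjection_apply_eq_zero_iff]
        exact L.le_orthogonal_orthogonal hlL
      rwa [h2, inner_zero_left, mul_zero, add_zero] at h1
    have hm0 : m = 0 := by
      refine hnor m hmL fun m' hm' => ?_
      have h1 := hv' m'
      rw [← hvd, hl0, zero_add, hhd, Submodule.starProjection_eq_self_iff.2 hmL] at h1
      exact h1
    rw [hl0, hm0, add_zero] at hvd
    rw [← hvd] at hv1
    simp at hv1
  -- The second kind of badness cannot occur: an element moving `c` moves it by at least `4 r`, but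
  -- if it fixed `x` it would move `c` by at most `2 * dist x c ≤ r`. A point `x` fixed by all of
  -- `Γ` would thus force the isotropy of `c` to be everything.
  · apply hT
    rw [eq_top_iff]
    intro γ _
    by_contra hγ
    have h1 := hsep γ hγ
    have h2 : ρ γ x = x := hxG γ trivial
    have h3 : dist (ρ γ c) c ≤ dist (ρ γ x) (ρ γ c) + dist x c := by
      rw [h2, dist_comm x (ρ γ c)]
      exact dist_triangle _ _ _
    rw [LinearIsometryEquiv.dist_map] at h3
    rw [mem_closedBall] at hxB
    linarith

end Perturbation

/-! ### The perturbation in a linear model, by induction over isotropy orders. -/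

section LinearStep

variable {n : ℕ} {Γ : Type*} [Group Γ] {ρ : Γ →* (Euc n ≃ₗᵢ[ℝ] Euc n)}

theorem isotropy_zero : isotropy ρ 0 = ⊤ := by
  ext γ
  simp

theorem GoodOn.congr {L : Submodule ℝ (Euc n)} {F F' : Euc n → ℝ} {S : Set (Euc n)}
    (h : GoodOn L F S) (hF : F = F') : GoodOn L F' S := hF ▸ h

theorem contDiffAt_two_add_admissible {F u : Euc n → ℝ} {η : ℝ} (hu : u ∈ admissible ρ η)
    {x : Euc n} (hF : ContDiffAt ℝ 2 F x) : ContDiffAt ℝ 2 (F + u) x :=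
  hF.add (hu.1.contDiffAt_two_of_smooth x)

variable [Fintype Γ]

/-- An invariant function can be modified near a nondegenerate critical point at the origin so
that its Hessian becomes positive definite across the fixed subspace. -/
theorem exists_positive_across_fixedSubspace {r η δ : ℝ} {g : Euc n → ℝ} (hη : 0 < η)
    (hηr : η < r) (hg : ∀ x ∈ ball 0 r, ContDiffAt ℝ 2 g x)
    (hinv : ∀ γ, ∀ x ∈ ball 0 r, g (ρ γ x) = g x)
    (hcrit : ∀ x ∈ ball 0 r, fderiv ℝ g x = 0 → x = 0) (h0 : fderiv ℝ g 0 = 0)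
    (hnd : ∀ v, (∀ w, hessian g 0 v w = 0) → v = 0) (hδ : 0 < δ) :
    ∃ u ∈ admissible ρ η, (∀ x, |u x| < δ) ∧
      GoodOn (fixedSubspace ρ ⊤) (g + u) (closedBall 0 η ∩ fixedSubspace ρ ⊤) := by
  set L := fixedSubspace ρ (⊤ : Subgroup Γ)
  -- Large enough to dominate the old Hessian in every normal direction. Only values need be small,
  -- so `b` stays fixed while the radius `s` of the cutoff shrinks.
  set b : ℝ := ‖hessian g 0‖ + 1
  have hb : 0 < b := by positivity
  have hN : (1 : ℝ) ≤ Nat.card Γ := Nat.one_le_cast.2 Nat.card_pos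
  obtain ⟨s, hs, hsη, hsδ⟩ : ∃ s > 0, 2 * s < η ∧ Nat.card Γ * (b * (2 * s) ^ 2) < δ := by
    have h1 : ∀ᶠ s : ℝ in 𝓝 0, 2 * s < η :=
      (continuous_const.mul continuous_id).continuousAt.eventually_lt_const (by simpa using hη)
    have h2 : ∀ᶠ s : ℝ in 𝓝 0, Nat.card Γ * (b * (2 * s) ^ 2) < δ := by
      have hc : Continuous fun s : ℝ => Nat.card Γ * (b * (2 * s) ^ 2) := by fun_prop
      exact hc.continuousAt.eventually_lt_const (by simpa using hδ)
    obtain ⟨s, h, h'⟩ := ((h1.and h2).filter_mono nhdsWithin_le_nhds |>.and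
      (self_mem_nhdsWithin : ∀ᶠ s : ℝ in 𝓝[>] 0, s ∈ Ioi 0)).exists
    exact ⟨s, h', h.1, h.2⟩
  have hball : closedBall (0 : Euc n) (2 * s) ⊆ ball 0 η := closedBall_subset_ball hsη
  have hsep : ∀ γ ∉ isotropy ρ 0, 4 * s ≤ dist (ρ γ 0) 0 := fun γ hγ => by
    rw [isotropy_zero] at hγ
    exact absurd trivial hγ
  have hL : fixedSubspace ρ (isotropy ρ 0) = L := by rw [isotropy_zero]
  have hNeq : Nat.card (isotropy ρ 0) = Nat.card Γ := by rw [isotropy_zero, Subgroup.card_top]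
  set u := cutModel ρ 0 hs 0 b
  have hu : u ∈ admissible ρ η := cutModel_mem_admissible hs hball _ _
  have hP : ∀ y : Euc n, ⟪Lᗮ.starProjection y, y⟫_ℝ = ‖Lᗮ.starProjection y‖ ^ 2 := fun y => by
    have := Submodule.re_inner_starProjection_eq_normSq (K := Lᗮ) y
    simpa using this
  have hterm : ∀ y : Euc n, bump (0 : Euc n) hs y * model L 0 b y =
      bump (0 : Euc n) hs y * (b * (2⁻¹ * ‖Lᗮ.starProjection y‖ ^ 2)) := fun y => by
    rw [model, inner_zero_left, zero_add, hP]
  have hu_apply : ∀ x, u x = ∑ γ, bump (0 : Euc n) hs (ρ γ x) * model L 0 b (ρ γ x) := fun x => by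
    rw [← hL]
    rfl
  have hu_nonneg : ∀ x, 0 ≤ u x := fun x => by
    rw [hu_apply]
    refine Finset.sum_nonneg fun γ _ => ?_
    rw [hterm]
    have := (bump (0 : Euc n) hs).nonneg (x := ρ γ x)
    positivity
  have hu_zero : ∀ x ∈ L, u x = 0 := fun x hx => by
    rw [hu_apply]
    refine Finset.sum_eq_zero fun γ _ => ?_
    have h1 : Lᗮ.starProjection x = 0 := by
      rw [Submodule.starProjection_apply_eq_zero_iff]
      exact L.le_orthogonal_orthogonal hx
    rw [hterm, hx γ trivial, h1]
    simp
  refine ⟨u, hu, fun x => ?_, ?_⟩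
  · rw [abs_of_nonneg (hu_nonneg x), hu_apply]
    calc ∑ γ, bump (0 : Euc n) hs (ρ γ x) * model L 0 b (ρ γ x)
        ≤ ∑ _γ : Γ, b * (2 * s) ^ 2 := by
          refine Finset.sum_le_sum fun γ _ => ?_
          rw [hterm]
          by_cases hy : ρ γ x ∈ ball 0 (2 * s)
          · have h1 : ‖Lᗮ.starProjection (ρ γ x)‖ ≤ ‖ρ γ x‖ :=
              Lᗮ.norm_starProjection_apply_le _
            have h2 : ‖ρ γ x‖ < 2 * s := by simpa using hy
            have h3 : ‖Lᗮ.starProjection (ρ γ x)‖ ^ 2 ≤ (2 * s) ^ 2 :=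
              pow_le_pow_left₀ (norm_nonneg _) (h1.trans h2.le) 2
            have h4 := (bump (0 : Euc n) hs).le_one (x := ρ γ x)
            refine (mul_le_of_le_one_left (by positivity) h4).trans ?_
            refine mul_le_mul_of_nonneg_left ?_ hb.le
            have h5 : 0 ≤ ‖Lᗮ.starProjection (ρ γ x)‖ ^ 2 := by positivity
            linarith
          · rw [bump_eq_zero hs hy, zero_mul]
            positivity
      _ = Nat.card Γ * (b * (2 * s) ^ 2) := by
          rw [Finset.sum_const, Finset.card_univ, Nat.card_eq_fintype_card, nsmul_eq_mul]
      _ < δ := hsδ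
  · rintro x ⟨hxη, hxL⟩ ⟨hc, hbad⟩
    have hxr : x ∈ ball 0 r := closedBall_subset_ball hηr hxη
    -- On `L` the function `u` attains its global minimum `0`, so critical points of `g + u` on `L`
    -- are those of `g`, that is, the origin.
    have hmin : fderiv ℝ u x = 0 := by
      apply IsLocalMin.fderiv_eq_zero
      refine Eventually.of_forall fun y => ?_
      rw [hu_zero x hxL]
      exact hu_nonneg y
    have hc' : fderiv ℝ (g + u) x = 0 := hc
    rw [(fderiv_add_eventuallyEq (hg x hxr) (hu.1.contDiffAt_two_of_smooth x)).eq_of_nhds, hmin,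
      add_zero] at hc'
    obtain rfl := hcrit x hxr hc'
    have hhd : ∀ v w, hessian (g + u) 0 v w =
        hessian g 0 v w + Nat.card Γ * (b * ⟪Lᗮ.starProjection v, w⟫_ℝ) := fun v w => by
      rw [hessian_add (hg 0 hxr) (hu.1.contDiffAt_two_of_smooth 0), add_apply, add_apply,
        hessian_cutModel hs hsep (Submodule.zero_mem _) _ (mem_ball_self hs), hNeq, hL]
    have hpos : ∀ v ∈ sphere (0 : Euc n) 1, v ∈ Lᗮ → 0 < hessian (g + u) 0 v v := by
      intro v hv hvL
      have hv1 : ‖v‖ = 1 := by simpa using hv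
      rw [hhd, Submodule.starProjection_eq_self_iff.2 hvL, real_inner_self_eq_norm_sq, hv1]
      have h1 : |hessian g 0 v v| ≤ ‖hessian g 0‖ := by
        have := (hessian g 0).le_opNorm₂ v v
        rwa [hv1, mul_one, mul_one, Real.norm_eq_abs] at this
      have h2 : b ≤ Nat.card Γ * b := le_mul_of_one_le_left hb.le hN
      have h3 := (abs_le.1 h1).1
      have h4 : b = ‖hessian g 0‖ + 1 := rfl
      nlinarith
    rcases hbad with ⟨v, hv1, hv⟩ | ⟨-, v, hv1, hvL, hv⟩
    · have hv' : ∀ w, hessian (g + u) 0 v w = 0 := fun w => congrArg (fun ℓ => ℓ w) hv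
      have hvd := add_starProjection_orthogonal L v
      set l := L.starProjection v
      set m := Lᗮ.starProjection v
      have hlL : l ∈ L := L.starProjection_apply_mem v
      have hmL : m ∈ Lᗮ := Lᗮ.starProjection_apply_mem v
      have hblock := fun {l m : Euc n} (hl : l ∈ L) (hm : m ∈ Lᗮ) =>
        hessian_block (F := g) (hg 0 hxr) hxL
          (fun γ _ => eventually_of_mem (isOpen_ball.mem_nhds hxr) fun y hy => hinv γ y hy)
          h0 hl hm
      -- The added term leaves the tangential block unchanged, so a tangential kernel vector of `g +
      -- u` is one of `g`.
      have hl0 : l = 0 := by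
        refine hnd l fun w => ?_
        rw [← add_starProjection_orthogonal L w, map_add,
          (hblock hlL (Lᗮ.starProjection_apply_mem w)).1, add_zero]
        have hw := L.starProjection_apply_mem w
        have h1 := hv' (L.starProjection w)
        rw [hhd, real_inner_comm, hmL _ hw, mul_zero, mul_zero, add_zero, ← hvd, map_add,
          add_apply, (hblock hw hmL).2, add_zero] at h1
        exact h1
      have hvL : v ∈ Lᗮ := by rw [← hvd, hl0, zero_add]; exact hmL
      exact (hpos v hv1 hvL).ne' (hv' v)
    · exact (hpos v hv1 hvL).not_ge hv

/-- It is a finite union of fixed subspaces, over the sufficiently large subgroups; isotropy can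
only jump up in a limit. -/
theorem isClosed_setOf_card_isotropy (j N : ℕ) :
    IsClosed {x : Euc n | N ≤ Nat.card (isotropy ρ x) + j} := by
  have h : {x : Euc n | N ≤ Nat.card (isotropy ρ x) + j} =
      ⋃ T : {T : Subgroup Γ // N ≤ Nat.card T + j}, (fixedSubspace ρ T.1 : Set (Euc n)) := by
    ext x
    simp only [mem_iUnion, SetLike.mem_coe]
    constructor
    · exact fun hx => ⟨⟨isotropy ρ x, hx⟩, fun γ hγ => hγ⟩
    · rintro ⟨⟨T, hT⟩, hx⟩
      have hle : T ≤ isotropy ρ x := fun γ hγ => hx γ hγ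
      exact hT.trans (Nat.add_le_add_right (Subgroup.card_le_of_le hle) j)
  rw [h]
  exact isClosed_iUnion_of_finite fun T => Submodule.closed_of_finiteDimensional _

/-- A ball around `c` that is moved off itself by everything outside the stabilizer of `c`. -/
theorem exists_separating_radius {c : Euc n} {η : ℝ} (hc : c ∈ ball 0 η) :
    ∃ r > 0, closedBall c (2 * r) ⊆ ball 0 η ∧
      ∀ γ ∉ isotropy ρ c, 4 * r ≤ dist (ρ γ c) c := by
  obtain ⟨ε, hε, hεs⟩ := nhds_basis_closedBall.mem_iff.1 (isOpen_ball.mem_nhds hc)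
  have h1 : ∀ γ, ∀ᶠ r : ℝ in 𝓝[>] 0, γ ∉ isotropy ρ c → 4 * r ≤ dist (ρ γ c) c := by
    intro γ
    by_cases hγ : γ ∈ isotropy ρ c
    · exact Eventually.of_forall fun r h => absurd hγ h
    · have hpos : 0 < dist (ρ γ c) c := dist_pos.2 hγ
      have : ∀ᶠ r : ℝ in 𝓝 0, 4 * r < dist (ρ γ c) c :=
        (continuous_const.mul continuous_id).continuousAt.eventually_lt_const (by simpa using hpos)
      exact (this.mono fun r hr _ => hr.le).filter_mono nhdsWithin_le_nhds
  have h2 : ∀ᶠ r : ℝ in 𝓝[>] 0, 2 * r < ε :=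
    ((continuous_const.mul continuous_id).continuousAt.eventually_lt_const
      (by simpa using hε)).filter_mono nhdsWithin_le_nhds
  obtain ⟨r, ⟨hr1, hr2⟩, hr⟩ := ((eventually_all.2 h1).and h2 |>.and
    (self_mem_nhdsWithin : ∀ᶠ s : ℝ in 𝓝[>] 0, s ∈ Ioi 0)).exists
  exact ⟨r, hr, (closedBall_subset_closedBall hr2.le).trans hεs, hr1⟩

/-- Finitely many local perturbations. -/
theorem exists_finite_perturbation {η : ℝ} {F : Euc n → ℝ} {S : Set (Euc n)}
    (hF : ∀ x ∈ closedBall 0 η, ContDiffAt ℝ 2 F x)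
    (hinv : ∀ γ, ∀ x ∈ ball 0 η, F (ρ γ x) = F x)
    (hS : IsCompact S) (hSη : S ⊆ closedBall 0 η)
    (hgood : GoodOn (fixedSubspace ρ ⊤) F S) (R : Euc n → ℝ) (t : Finset (Euc n))
    (hR : ∀ c ∈ t, 0 < R c ∧ closedBall c (2 * R c) ⊆ ball 0 η ∧
      (∀ γ ∉ isotropy ρ c, 4 * R c ≤ dist (ρ γ c) c) ∧ isotropy ρ c ≠ ⊤) :
    ∀ δ > 0, ∃ u ∈ admissible ρ η, (∀ x, |u x| < δ) ∧ GoodOn (fixedSubspace ρ ⊤) (F + u)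
      (S ∪ ⋃ c ∈ t, closedBall c (R c / 2) ∩ fixedSubspace ρ (isotropy ρ c)) := by
  classical
  induction t using Finset.induction_on with
  | empty =>
    intro δ hδ
    refine ⟨0, Submodule.zero_mem _, by simpa using hδ, ?_⟩
    simpa using hgood
  | insert c t hct ih =>
    intro δ hδ
    obtain ⟨u, hu, huδ, hugood⟩ := ih (fun c hc => hR c (Finset.mem_insert_of_mem hc)) (δ / 2)
      (half_pos hδ)
    obtain ⟨hr, hball, hsep, hT⟩ := hR c (Finset.mem_insert_self c t)
    have hcpt : IsCompact
        (S ∪ ⋃ c ∈ t, closedBall c (R c / 2) ∩ fixedSubspace ρ (isotropy ρ c)) :=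
      hS.union (t.isCompact_biUnion fun c _ => (isCompact_closedBall c _).inter_right
        (Submodule.closed_of_finiteDimensional _))
    have hsub : (S ∪ ⋃ c ∈ t, closedBall c (R c / 2) ∩ fixedSubspace ρ (isotropy ρ c)) ⊆
        closedBall 0 η := by
      refine union_subset hSη (iUnion₂_subset fun c hc x hx => ?_)
      obtain ⟨h1, h2, -⟩ := hR c (Finset.mem_insert_of_mem hc)
      exact ball_subset_closedBall (h2 (closedBall_subset_closedBall (by linarith) hx.1))
    obtain ⟨v, hv, hvδ, hvgood⟩ := exists_local_perturbation hr hball hsep hT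
      (fun x hx => contDiffAt_two_add_admissible hu (hF x hx))
      (fun γ x hx => by rw [Pi.add_apply, Pi.add_apply, hinv γ x hx, hu.2.1 γ x])
      hcpt hsub hugood (half_pos hδ)
    refine ⟨u + v, Submodule.add_mem _ hu hv, fun x => ?_, ?_⟩
    · have := (abs_add_le (u x) (v x)).trans_lt (add_lt_add (huδ x) (hvδ x))
      rwa [add_halves] at this
    · refine (hvgood.mono ?_).congr (add_assoc F u v)
      rw [Finset.set_biUnion_insert]
      intro x hx
      rcases hx with hx | hx | hx
      · exact Or.inl (Or.inl hx)
      · exact Or.inr hx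
      · exact Or.inl (Or.inr hx)

/-- An invariant function with a single critical point, which is nondegenerate, has small
invariant perturbations with only nondegenerate critical points, such that those fixed by the
whole group have a Hessian that is positive definite across the fixed subspace. -/
theorem exists_linear_step {r η δ : ℝ} {g : Euc n → ℝ} (hη : 0 < η)
    (hηr : η < r) (hg : ∀ x ∈ ball 0 r, ContDiffAt ℝ 2 g x)
    (hinv : ∀ γ, ∀ x ∈ ball 0 r, g (ρ γ x) = g x)
    (hcrit : ∀ x ∈ ball 0 r, fderiv ℝ g x = 0 → x = 0) (h0 : fderiv ℝ g 0 = 0)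
    (hnd : ∀ v, (∀ w, hessian g 0 v w = 0) → v = 0) (hδ : 0 < δ) :
    ∃ u ∈ admissible ρ η, (∀ x, |u x| < δ) ∧
      GoodOn (fixedSubspace ρ ⊤) (g + u) (closedBall 0 η) := by
  have hηr' : closedBall (0 : Euc n) η ⊆ ball 0 r := closedBall_subset_ball hηr
  -- Stage `j` treats the points with isotropy of order at least `Nat.card Γ - j`, written
  -- additively. At `j = Nat.card Γ` this is the whole ball.
  suffices H : ∀ j : ℕ, ∀ δ > 0, ∃ u ∈ admissible ρ η, (∀ x, |u x| < δ) ∧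
      GoodOn (fixedSubspace ρ ⊤) (g + u)
        (closedBall 0 η ∩ {x | Nat.card Γ ≤ Nat.card (isotropy ρ x) + j}) by
    obtain ⟨u, hu, huδ, h⟩ := H (Nat.card Γ) δ hδ
    exact ⟨u, hu, huδ, h.mono fun x hx => ⟨hx, Nat.le_add_left _ _⟩⟩
  intro j
  induction j with
  | zero =>
    intro δ hδ
    obtain ⟨u, hu, huδ, h⟩ :=
      exists_positive_across_fixedSubspace hη hηr hg hinv hcrit h0 hnd hδ
    refine ⟨u, hu, huδ, h.mono ?_⟩
    rintro x ⟨hx, hcard⟩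
    refine ⟨hx, fun γ _ => ?_⟩
    have : isotropy ρ x = ⊤ := Subgroup.eq_top_of_le_card _ hcard
    exact (this ▸ Subgroup.mem_top γ : γ ∈ isotropy ρ x)
  | succ j ih =>
    intro δ hδ
    obtain ⟨u, hu, huδ, hgood⟩ := ih (δ / 2) (half_pos hδ)
    set D : Set (Euc n) := closedBall 0 η ∩ {x | Nat.card Γ ≤ Nat.card (isotropy ρ x) + (j + 1)}
    have hD : IsCompact D := (isCompact_closedBall 0 η).inter_right
      (isClosed_setOf_card_isotropy _ _)
    have hF : ∀ x ∈ closedBall 0 η, ContDiffAt ℝ 2 (g + u) x := fun x hx =>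
      contDiffAt_two_add_admissible hu (hg x (hηr' hx))
    have hFinv : ∀ γ, ∀ x ∈ ball 0 η, (g + u) (ρ γ x) = (g + u) x := fun γ x hx => by
      rw [Pi.add_apply, Pi.add_apply, hinv γ x (hηr' (ball_subset_closedBall hx)), hu.2.1 γ x]
    set Z := {x | x ∈ D ∧ jet (g + u) x ∈ badJets (fixedSubspace ρ ⊤)}
    have hZ : IsCompact Z := isCompact_setOf_bad hD fun x hx => hF x hx.1
    -- Near the boundary sphere `u` vanishes, and `g` is critical only at the origin; so bad points
    -- are interior, with room for a cutoff.
    have hZη : ∀ c ∈ Z, c ∈ ball 0 η := by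
      intro c hc
      by_contra hcη
      have hsupp : c ∉ tsupport u := fun h => hcη (hu.2.2 h)
      have hev : g + u =ᶠ[𝓝 c] g := by
        filter_upwards [notMem_tsupport_iff_eventuallyEq.1 hsupp] with y hy
        rw [Pi.add_apply, hy, Pi.zero_apply, add_zero]
      have h1 : fderiv ℝ (g + u) c = 0 := hc.2.1
      rw [hev.fderiv_eq] at h1
      rw [hcrit c (hηr' hc.1.1) h1] at hcη
      exact hcη (mem_ball_self hη)
    -- Larger isotropy orders are good by the previous stage, so the remaining bad points have
    -- exactly the new order.
    have hZcard : ∀ c ∈ Z, Nat.card (isotropy ρ c) + (j + 1) = Nat.card Γ := by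
      intro c hc
      refine le_antisymm ?_ hc.1.2
      by_contra! hlt
      exact hgood c ⟨hc.1.1, Nat.le_of_lt_succ hlt⟩ hc.2
    choose! R hR hRball hRsep using fun c (hc : c ∈ Z) =>
      exists_separating_radius (ρ := ρ) (hZη c hc)
    obtain ⟨t, htZ, hcover⟩ := hZ.elim_nhds_subcover (fun c => ball c (R c / 2))
      fun c hc => ball_mem_nhds c (half_pos (hR c hc))
    set S₀ := D \ ⋃ c ∈ t, ball c (R c / 2)
    have hS₀ : IsCompact S₀ := hD.diff (isOpen_biUnion fun c _ => isOpen_ball)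
    have hS₀good : GoodOn (fixedSubspace ρ ⊤) (g + u) S₀ := fun x hx hbad =>
      hx.2 (hcover ⟨hx.1, hbad⟩)
    obtain ⟨v, hv, hvδ, hvgood⟩ := exists_finite_perturbation hF hFinv hS₀
      (fun x hx => hx.1.1) hS₀good R t (fun c hc => ⟨hR c (htZ c hc), hRball c (htZ c hc),
        hRsep c (htZ c hc), fun h => by
          have := hZcard c (htZ c hc)
          rw [h, Subgroup.card_top] at this
          omega⟩) (δ / 2) (half_pos hδ)
    refine ⟨u + v, Submodule.add_mem _ hu hv, fun x => ?_, ?_⟩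
    · have := (abs_add_le (u x) (v x)).trans_lt (add_lt_add (huδ x) (hvδ x))
      rwa [add_halves] at this
    · refine (hvgood.mono fun x hx => ?_).congr (add_assoc g u v)
      by_cases hxt : x ∈ ⋃ c ∈ t, ball c (R c / 2)
      · right
        simp only [mem_iUnion] at hxt ⊢
        obtain ⟨c, hc, hxc⟩ := hxt
        have hcZ := htZ c hc
        refine ⟨c, hc, ball_subset_closedBall hxc, ?_⟩
        -- Separation makes isotropy near `c` no larger than at `c`, and `x ∈ D` bounds its order
        -- below by that of `c`. The groups agree, so `x` lies in the fixed subspace controlled by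
        -- the perturbation.
        have hle : isotropy ρ x ≤ isotropy ρ c := by
          intro γ hγ
          by_contra hγc
          have h1 := hRsep c hcZ γ hγc
          have h2 : ρ γ x = x := hγ
          have h3 : dist (ρ γ c) c ≤ dist (ρ γ x) (ρ γ c) + dist x c := by
            rw [h2, dist_comm x (ρ γ c)]
            exact dist_triangle _ _ _
          rw [LinearIsometryEquiv.dist_map] at h3
          rw [mem_ball] at hxc
          have := hR c hcZ
          linarith
        have hcard : Nat.card (isotropy ρ c) ≤ Nat.card (isotropy ρ x) := by
          have h1 := hZcard c hcZ
          have h2 : Nat.card Γ ≤ Nat.card (isotropy ρ x) + (j + 1) := hx.2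
          omega
        have heq := Subgroup.eq_of_le_of_card_ge hle hcard
        exact fun γ hγ => (heq ▸ hγ : γ ∈ isotropy ρ x)
      · exact Or.inl ⟨hx, hxt⟩

end LinearStep

/-! ### Germs of coordinate changes between orbifold charts. -/

namespace OrbifoldChart

variable {n : ℕ} {X : Type*} [TopologicalSpace X]

/-- Two charts are related near the points `x` and `x'` by a diffeomorphism over `X`. -/
def Glued (c c' : OrbifoldChart n X) (x x' : Euc n) : Prop :=
  ∃ e : OpenPartialHomeomorph (Euc n) (Euc n), e.IsDiffeo ∧ x ∈ e.source ∧ e x = x' ∧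
    e.source ⊆ c.V ∧ e.target ⊆ c'.V ∧ ∀ y ∈ e.source, c'.φ (e y) = c.φ y

variable {c c' c'' : OrbifoldChart n X} {x x' x'' : Euc n}

theorem Glued.symm (h : Glued c c' x x') : Glued c' c x' x := by
  obtain ⟨e, he, hx, rfl, hs, ht, hφ⟩ := h
  refine ⟨e.symm, he.symm, e.map_source hx, e.left_inv hx, ht, hs, fun y hy => ?_⟩
  rw [← hφ _ (e.map_target hy), e.right_inv hy]

theorem Glued.trans (h : Glued c c' x x') (h' : Glued c' c'' x' x'') : Glued c c'' x x'' := by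
  obtain ⟨e, he, hx, rfl, hs, ht, hφ⟩ := h
  obtain ⟨e', he', hx', rfl, hs', ht', hφ'⟩ := h'
  refine ⟨e.trans e', he.trans he', ?_, rfl, ?_, ?_, ?_⟩
  · rw [OpenPartialHomeomorph.trans_source]
    exact ⟨hx, hx'⟩
  · rw [OpenPartialHomeomorph.trans_source]
    exact inter_subset_left.trans hs
  · rw [OpenPartialHomeomorph.trans_target]
    exact inter_subset_left.trans ht'
  · intro y hy
    rw [OpenPartialHomeomorph.trans_source] at hy
    rw [← hφ y hy.1, ← hφ' _ hy.2]
    rfl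

theorem act_inv_act (c : OrbifoldChart n X) (γ : c.Γ) (hx : x ∈ c.V) :
    c.act γ⁻¹ (c.act γ x) = x := by
  rw [← c.act_mul _ _ x hx, inv_mul_cancel, c.act_one x hx]

theorem act_act_inv (c : OrbifoldChart n X) (γ : c.Γ) (hx : x ∈ c.V) :
    c.act γ (c.act γ⁻¹ x) = x := by
  rw [← c.act_mul _ _ x hx, mul_inv_cancel, c.act_one x hx]

theorem φ_act (c : OrbifoldChart n X) (γ : c.Γ) (hx : x ∈ c.V) : c.φ (c.act γ x) = c.φ x :=
  ((c.φ_eq_iff x hx _ (c.act_mem γ x hx)).2 ⟨γ, rfl⟩).symm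

theorem glued_act (c : OrbifoldChart n X) (γ : c.Γ) (hx : x ∈ c.V) : Glued c c x (c.act γ x) := by
  let e : OpenPartialHomeomorph (Euc n) (Euc n) :=
    { toFun := c.act γ
      invFun := c.act γ⁻¹
      source := c.V
      target := c.V
      map_source' := fun y hy => c.act_mem γ y hy
      map_target' := fun y hy => c.act_mem γ⁻¹ y hy
      left_inv' := fun y hy => c.act_inv_act γ hy
      right_inv' := fun y hy => c.act_act_inv γ hy
      open_source := c.isOpen_V
      open_target := c.isOpen_V
      continuousOn_toFun := (c.act_smooth γ).continuousOn
      continuousOn_invFun := (c.act_smooth γ⁻¹).continuousOn }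
  exact ⟨e, ⟨c.act_smooth γ, c.act_smooth γ⁻¹⟩, hx, rfl, Subset.rfl, Subset.rfl,
    fun y hy => c.φ_act γ hy⟩

theorem EmbedsIn.exists_glued (h : c.EmbedsIn c') (hx : x ∈ c.V) :
    ∃ x' ∈ c'.V, Glued c c' x x' := by
  obtain ⟨ψ, θ, hψ, hmaps, -, himm, hφ, -, -⟩ := h
  obtain ⟨e, he, hxe, hes, heψ⟩ :=
    exists_isDiffeo_of_injective_fderiv c.isOpen_V hψ hx (himm x hx)
  refine ⟨ψ x, hmaps hx, e, he, hxe, heψ x, hes, fun y hy => ?_, fun y hy => ?_⟩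
  · have := hmaps (hes (e.map_target hy))
    rwa [← heψ, e.right_inv hy] at this
  · rw [heψ, hφ y (hes hy)]

/-- A common chart relates some lifts of the point, not necessarily the given ones; group elements
in either chart move them to the prescribed lifts. -/
theorem Compatible.glued (h : c.Compatible c') (hx : x ∈ c.V) (hx' : x' ∈ c'.V)
    (heq : c.φ x = c'.φ x') : Glued c c' x x' := by
  obtain ⟨d, ⟨z, hz, hzx⟩, hdc, hdc'⟩ := h (c.φ x) ⟨⟨x, hx, rfl⟩, ⟨x', hx', heq.symm⟩⟩
  have key : ∀ {c₀ : OrbifoldChart n X} {x₀ : Euc n}, x₀ ∈ c₀.V → d.EmbedsIn c₀ →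
      c₀.φ x₀ = d.φ z → Glued d c₀ z x₀ := by
    intro c₀ x₀ hx₀ hd hφ
    obtain ⟨y, hy, hg⟩ := hd.exists_glued hz
    have hyx : c₀.φ y = c₀.φ x₀ := by
      obtain ⟨e, -, hze, rfl, -, -, he⟩ := hg
      rw [he z hze, hφ]
    obtain ⟨γ, rfl⟩ := (c₀.φ_eq_iff y hy x₀ hx₀).1 hyx
    exact hg.trans (c₀.glued_act γ hy)
  exact (key hx hdc hzx.symm).symm.trans (key hx' hdc' (heq ▸ hzx.symm))

theorem continuousAt_φ (c : OrbifoldChart n X) (hx : x ∈ c.V) : ContinuousAt c.φ x :=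
  c.φ_continuousOn.continuousAt (c.isOpen_V.mem_nhds hx)

theorem comp_φ_eventuallyEq {f f' : X → ℝ} (hx : x ∈ c.V) (h : f =ᶠ[𝓝 (c.φ x)] f') :
    f ∘ c.φ =ᶠ[𝓝 x] f' ∘ c.φ :=
  (c.continuousAt_φ hx).eventually h

theorem Glued.morseAt {k : ℕ∞} (hk : 2 ≤ k) (h : Glued c c' x x') {f : X → ℝ}
    (hf : MorseAt k (f ∘ c'.φ) x') : MorseAt k (f ∘ c.φ) x := by
  obtain ⟨e, he, hx, rfl, -, -, hφ⟩ := h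
  refine (he.morseAt_comp hx hk hf).congr ?_
  filter_upwards [e.open_source.mem_nhds hx] with y hy
  simp [hφ y hy]

theorem Glued.fderiv_eq_zero_iff (h : Glued c c' x x') {f : X → ℝ}
    (hf : DifferentiableAt ℝ (f ∘ c'.φ) x') :
    fderiv ℝ (f ∘ c.φ) x = 0 ↔ fderiv ℝ (f ∘ c'.φ) x' = 0 := by
  obtain ⟨e, he, hx, rfl, -, -, hφ⟩ := h
  have hev : f ∘ c.φ =ᶠ[𝓝 x] (f ∘ c'.φ) ∘ e := by
    filter_upwards [e.open_source.mem_nhds hx] with y hy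
    simp [hφ y hy]
  rw [hev.fderiv_eq, he.fderiv_comp_eq_zero_iff hx hf]

end OrbifoldChart

/-! ### Morse functions and critical points independently of the chart. -/

namespace OrbifoldStructure

variable {n : ℕ} {X : Type*} [TopologicalSpace X] {O : OrbifoldStructure n X} {k : ℕ∞}
  {f f' : X → ℝ} {p : X}

theorem isChart_of_mem_atlas {c : OrbifoldChart n X} (hc : c ∈ O.atlas) : O.IsChart c :=
  O.compatible c hc

/-- Charts of the maximal atlas are assumed compatible only with the given atlas, so the comparison
passes through an atlas chart covering the point. -/
theorem IsChart.glued {c c' : OrbifoldChart n X} (hc : O.IsChart c) (hc' : O.IsChart c')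
    {x x' : Euc n} (hx : x ∈ c.V) (hx' : x' ∈ c'.V) (heq : c.φ x = c'.φ x') :
    c.Glued c' x x' := by
  obtain ⟨d, hd, y, hy, hyx⟩ := O.covers (c.φ x)
  exact ((hc d hd).glued hx hy hyx.symm).trans
    ((hc' d hd).glued hx' hy (heq.symm.trans hyx.symm)).symm

theorem IsMorse.morseAt (hf : O.IsMorse k f) {c : OrbifoldChart n X} (hc : O.IsChart c)
    {x : Euc n} (hx : x ∈ c.V) : MorseAt k (f ∘ c.φ) x :=
  (isMorseOn_iff c.isOpen_V).1 (hf c hc) x hx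

/-- The Morse property may be checked at one lift of each point. -/
theorem isMorse_of_forall_exists (hk : 2 ≤ k)
    (h : ∀ p, ∃ c, O.IsChart c ∧ ∃ x ∈ c.V, c.φ x = p ∧ MorseAt k (f ∘ c.φ) x) :
    O.IsMorse k f := by
  intro c hc
  rw [isMorseOn_iff c.isOpen_V]
  intro x hx
  obtain ⟨c', hc', x', hx', heq, hm⟩ := h (c.φ x)
  exact (hc.glued hc' hx hx' heq.symm).morseAt hk hm

/-- The Morse property is local. -/
theorem isMorse_of_local (hk : 2 ≤ k)
    (h : ∀ p, ∃ f₁, O.IsMorse k f₁ ∧ f₁ =ᶠ[𝓝 p] f) : O.IsMorse k f := by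
  refine isMorse_of_forall_exists hk fun p => ?_
  obtain ⟨f₁, hf₁, heq⟩ := h p
  obtain ⟨c, hc, x, hx, rfl⟩ := O.covers p
  exact ⟨c, isChart_of_mem_atlas hc, x, hx, rfl,
    (hf₁.morseAt (isChart_of_mem_atlas hc) hx).congr (c.comp_φ_eventuallyEq hx heq)⟩

theorem IsCritical.congr (h : O.IsCritical f p) (heq : f =ᶠ[𝓝 p] f') : O.IsCritical f' p := by
  obtain ⟨c, hc, x, hx, rfl, h0⟩ := h
  refine ⟨c, hc, x, hx, rfl, ?_⟩
  rwa [← (c.comp_φ_eventuallyEq hx heq).fderiv_eq]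

theorem IsStableAt.congr (h : O.IsStableAt f p) (heq : f =ᶠ[𝓝 p] f') : O.IsStableAt f' p := by
  obtain ⟨c, hc, x, hx, rfl, h0⟩ := h
  refine ⟨c, hc, x, hx, rfl, ?_⟩
  rwa [← hessian_congr (c.comp_φ_eventuallyEq hx heq)]

/-- The definition allows any chart and lift; gluing makes the vanishing of the derivative
independent of both. -/
theorem isCritical_iff (hk : 2 ≤ k) (hf : O.IsMorse k f) {c : OrbifoldChart n X}
    (hc : O.IsChart c) {x : Euc n} (hx : x ∈ c.V) :
    O.IsCritical f (c.φ x) ↔ fderiv ℝ (f ∘ c.φ) x = 0 := by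
  refine ⟨?_, fun h => ⟨c, hc, x, hx, rfl, h⟩⟩
  rintro ⟨c', hc', x', hx', heq, h0⟩
  have hd : DifferentiableAt ℝ (f ∘ c'.φ) x' :=
    ((hf.morseAt hc' hx').contDiffAt_two hk).differentiableAt (by norm_num)
  exact ((hc.glued hc' hx hx' heq.symm).fderiv_eq_zero_iff hd).2 h0

/-- The critical points of a Morse function are isolated. -/
theorem IsMorse.eventually_not_isCritical (hk : 2 ≤ k) (hf : O.IsMorse k f) (p : X) :
    ∀ᶠ q in 𝓝[≠] p, ¬ O.IsCritical f q := by
  obtain ⟨c, hc, x, hx, rfl⟩ := O.covers p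
  have hc' := isChart_of_mem_atlas hc
  have h1 := (hf.morseAt hc' hx).eventually_fderiv_ne_zero hk
  rw [eventually_nhdsWithin_iff] at h1
  obtain ⟨W, hW, hWo, hxW⟩ := _root_.mem_nhds_iff.1 (h1.and (c.isOpen_V.mem_nhds hx))
  rw [eventually_nhdsWithin_iff]
  filter_upwards [(c.φ_isOpen_image W (fun y hy => (hW hy).2) hWo).mem_nhds ⟨x, hxW, rfl⟩]
  rintro q ⟨y, hy, rfl⟩ hne
  rw [isCritical_iff hk hf hc' (hW hy).2]
  exact (hW hy).1 fun h => hne (by rw [mem_singleton_iff.1 h]; rfl)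

end OrbifoldStructure

/-! ### Separating the critical points and gluing local modifications. -/

/-- The points of a closed discrete subset of a paracompact Hausdorff space have arbitrarily small
disjoint neighbourhoods that form a locally finite family. -/
theorem exists_disjoint_locallyFinite_nhds {X : Type*} [TopologicalSpace X] [T2Space X]
    [ParacompactSpace X] {C : Set X} (hC : ∀ p, ∀ᶠ q in 𝓝[≠] p, q ∉ C) {M : C → Set X}
    (hM : ∀ p : C, M p ∈ 𝓝 (p : X)) :
    ∃ N : C → Set X, (∀ p, IsOpen (N p)) ∧ (∀ p : C, (p : X) ∈ N p) ∧ (∀ p, N p ⊆ M p) ∧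
      (∀ p q, ∀ x, x ∈ N p → x ∈ N q → p = q) ∧ LocallyFinite N ∧
      ∀ p : C, ∀ q ∈ N p, q ∈ C → q = p := by
  have hclosed : IsClosed C := by
    rw [← isOpen_compl_iff, isOpen_iff_mem_nhds]
    intro p hp
    have := hC p
    rw [eventually_nhdsWithin_iff] at this
    filter_upwards [this] with q hq
    by_cases h : q = p
    · rwa [h]
    · exact hq h
  have hA : ∀ p : C, ∃ A, IsOpen A ∧ (p : X) ∈ A ∧ A ⊆ M p ∧ ∀ q ∈ A, q ∈ C → q = p := by
    intro p
    have h1 := hC p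
    rw [eventually_nhdsWithin_iff] at h1
    obtain ⟨A, hAs, hAo, hpA⟩ := _root_.mem_nhds_iff.1 (h1.and (hM p))
    refine ⟨A, hAo, hpA, fun q hq => (hAs hq).2, fun q hq hqC => ?_⟩
    by_contra hne
    exact (hAs hq).1 hne hqC
  choose A hAo hpA hAM hAC using hA
  -- The complement of `C` completes the `A p` to a cover. As `A p` is the only member containing
  -- `p`, its refinement must still contain `p`.
  obtain ⟨v, hvo, hvc, hvlf, hvs⟩ := precise_refinement
    (fun o : Option C => o.elim Cᶜ A)
    (fun o => by cases o with
      | none => exact hclosed.isOpen_compl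
      | some p => exact hAo p)
    (by
      rw [eq_univ_iff_forall]
      intro x
      by_cases hx : x ∈ C
      · exact mem_iUnion.2 ⟨some ⟨x, hx⟩, hpA _⟩
      · exact mem_iUnion.2 ⟨none, hx⟩)
  have hpv : ∀ p : C, (p : X) ∈ v (some p) := by
    intro p
    obtain ⟨o, ho⟩ := mem_iUnion.1 (hvc.symm ▸ mem_univ (p : X) : (p : X) ∈ ⋃ o, v o)
    cases o with
    | none => exact absurd p.2 (hvs _ ho)
    | some q =>
      have : p = q := Subtype.ext (hAC q p (hvs _ ho) p.2)
      rw [this]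
      exact this ▸ ho
  have hw : ∀ p : C, ∃ w, IsOpen w ∧ (p : X) ∈ w ∧ closure w ⊆ v (some p) := by
    intro p
    obtain ⟨w, hwo, hpw, hws⟩ := normal_exists_closure_subset (s := {(p : X)}) isClosed_singleton
      (hvo (some p)) (singleton_subset_iff.2 (hpv p))
    exact ⟨w, hwo, singleton_subset_iff.1 hpw, hws⟩
  choose w hwo hpw hws using hw
  have hlf : LocallyFinite fun p => closure (w p) :=
    (hvlf.comp_injective (Option.some_injective C)).subset hws
  -- Local finiteness makes the union of the other closures closed, so removing it from `w p` leaves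
  -- an open set; this gives disjointness.
  have hF : ∀ p : C, IsClosed (⋃ q : {q : C // q ≠ p}, closure (w q)) := fun p =>
    (hlf.comp_injective Subtype.val_injective).isClosed_iUnion fun q => isClosed_closure
  have hwA : ∀ p, closure (w p) ⊆ A p := fun p => (hws p).trans (hvs (some p))
  refine ⟨fun p => w p \ ⋃ q : {q : C // q ≠ p}, closure (w q), fun p => (hwo p).sdiff (hF p),
    fun p => ⟨hpw p, fun h => ?_⟩, fun p x hx => hAM p (hwA p (subset_closure hx.1)),
    fun p q x hxp hxq => ?_, hlf.subset fun p => sdiff_subset.trans subset_closure,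
    fun p q hq => hAC p q (hwA p (subset_closure hq.1))⟩
  · obtain ⟨q, hq⟩ := mem_iUnion.1 h
    exact q.2 (Subtype.ext (hAC q p (hwA q hq) p.2)).symm
  · by_contra hne
    exact hxp.2 (mem_iUnion.2 ⟨⟨q, fun h => hne h.symm⟩, subset_closure hxq.1⟩)

namespace OrbifoldStructure

variable {n : ℕ} {X : Type*} [TopologicalSpace X] {O : OrbifoldStructure n X} {k : ℕ∞}

variable (O k) in
/-- The Morse function `f` can be made stable by small modifications near the point `p`. -/
def Stabilizable (f : X → ℝ) (p : X) : Prop :=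
  ∀ N, IsOpen N → p ∈ N → (∀ q ∈ N, O.IsCritical f q → q = p) → ∀ δ > 0,
    ∃ g : X → ℝ, O.IsMorse k g ∧ closure {x | g x ≠ f x} ⊆ N ∧ (∀ x, |g x - f x| < δ) ∧
      ∀ q ∈ N, O.IsCritical g q → O.IsStableAt g q

/-- Modifications near the critical points in an open set can be carried out simultaneously. -/
theorem exists_stable_of_forall_stabilizable [T2Space X] [ParacompactSpace X] (hk : 2 ≤ k)
    {f : X → ℝ} (hf : O.IsMorse k f) {U : Set X} (hU : IsOpen U)
    (hstab : ∀ p ∈ U, O.IsCritical f p → O.Stabilizable k f p)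
    {ε : X → ℝ} (hε : Continuous ε) (hε_pos : ∀ x, 0 < ε x) :
    ∃ f' : X → ℝ, O.IsMorse k f' ∧ closure {x | f' x ≠ f x} ⊆ U ∧ (∀ x, |f' x - f x| < ε x) ∧
      ∀ q ∈ U, O.IsCritical f' q → O.IsStableAt f' q := by
  classical
  let C : Set X := {p | O.IsCritical f p}
  obtain ⟨N, hNo, hpN, hNM, hNdisj, hNlf, hNC⟩ := exists_disjoint_locallyFinite_nhds (C := C)
    -- On such a neighbourhood the constant `ε p / 2` is a valid bound in place of the function `ε`,
    -- and neighbourhoods of points of `U` stay inside `U`.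
    (M := fun p => {x | ε p / 2 < ε x ∧ ((p : X) ∈ U → x ∈ U)})
    (hf.eventually_not_isCritical hk) (fun p => by
      refine (hε.continuousAt.eventually_const_lt (half_lt_self (hε_pos p))).and ?_
      by_cases hp : (p : X) ∈ U
      · filter_upwards [hU.mem_nhds hp] with x hx _ using hx
      · exact Eventually.of_forall fun x h => absurd h hp)
  let I := {p : C // (p : X) ∈ U}
  have hloc : ∀ p : I, ∃ f' : X → ℝ, O.IsMorse k f' ∧ closure {x | f' x ≠ f x} ⊆ N p ∧
      (∀ x, |f' x - f x| < ε p / 2) ∧ ∀ q ∈ N p, O.IsCritical f' q → O.IsStableAt f' q :=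
    fun p => hstab p p.2 p.1.2 (N p) (hNo p) (hpN p) (fun q hq hc => hNC p q hq hc) _
      (half_pos (hε_pos p))
  choose F hFm hFN hFε hFs using hloc
  let K : I → Set X := fun p => closure {x | F p x ≠ f x}
  have hKclosed : IsClosed (⋃ p, K p) :=
    ((hNlf.comp_injective Subtype.val_injective).subset hFN).isClosed_iUnion
      fun p => isClosed_closure
  let f' : X → ℝ := fun x => if h : ∃ p : I, x ∈ N p then F h.choose x else f x
  have hf'N : ∀ p : I, ∀ x ∈ N p, f' x = F p x := by
    intro p x hx
    have h : ∃ p : I, x ∈ N p := ⟨p, hx⟩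
    have heq : h.choose = p := Subtype.ext (hNdisj _ _ x h.choose_spec hx)
    simp only [f', dif_pos h, heq]
  have hf'K : ∀ x, x ∉ ⋃ p, K p → f' x = f x := by
    intro x hx
    by_cases h : ∃ p : I, x ∈ N p
    · obtain ⟨p, hp⟩ := h
      rw [hf'N p x hp]
      by_contra hne
      exact hx (mem_iUnion.2 ⟨p, subset_closure hne⟩)
    · simp only [f', dif_neg h]
  have hevN : ∀ p : I, ∀ x ∈ N p, F p =ᶠ[𝓝 x] f' := fun p x hx => by
    filter_upwards [(hNo p).mem_nhds hx] with y hy using (hf'N p y hy).symm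
  have hevK : ∀ x, x ∉ ⋃ p, K p → f =ᶠ[𝓝 x] f' := fun x hx => by
    filter_upwards [hKclosed.isOpen_compl.mem_nhds hx] with y hy using (hf'K y hy).symm
  have hcl : closure {x | f' x ≠ f x} ⊆ ⋃ p, K p :=
    closure_minimal (fun x hx => by_contra fun h => hx (hf'K x h)) hKclosed
  refine ⟨f', isMorse_of_local hk fun x => ?_, ?_, fun x => ?_, fun q hq hc => ?_⟩
  · by_cases h : x ∈ ⋃ p, K p
    · obtain ⟨p, hp⟩ := mem_iUnion.1 h
      exact ⟨F p, hFm p, hevN p x (hFN p hp)⟩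
    · exact ⟨f, hf, hevK x h⟩
  · refine hcl.trans (iUnion_subset fun p x hx => ?_)
    exact (hNM p (hFN p hx)).2 p.2
  · by_cases h : x ∈ ⋃ p, K p
    · obtain ⟨p, hp⟩ := mem_iUnion.1 h
      rw [hf'N p x (hFN p hp)]
      exact (hFε p x).trans (hNM p (hFN p hp)).1
    · rw [hf'K x h, sub_self, abs_zero]
      exact hε_pos x
  · by_cases h : q ∈ ⋃ p, K p
    · obtain ⟨p, hp⟩ := mem_iUnion.1 h
      have hev := hevN p q (hFN p hp)
      exact (hFs p q (hFN p hp) (hc.congr hev.symm)).congr hev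
    -- Away from all supports `q` was already critical for `f`, so it is one of the centres, and the
    -- local conclusion on its own neighbourhood applies.
    · have hcf : O.IsCritical f q := hc.congr (hevK q h).symm
      let p : I := ⟨⟨q, hcf⟩, hq⟩
      have hev := hevN p q (hpN p)
      exact (hFs p q (hpN p) (hc.congr hev.symm)).congr hev

end OrbifoldStructure

/-! ### Linearizing the stabilizer action. -/

/-- Every linear representation of a finite group on Euclidean space is conjugate to an isometric
one. -/
theorem exists_unitarization {n : ℕ} {S : Type*} [Group S] [Finite S]
    (A : S →* (Euc n →L[ℝ] Euc n)) :
    ∃ (T : Euc n ≃L[ℝ] Euc n) (ρ : S →* (Euc n ≃ₗᵢ[ℝ] Euc n)), ∀ γ v, ρ γ (T v) = T (A γ v) := by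
  classical
  have := Fintype.ofFinite S
  have hA : ∀ γ δ v, A (γ * δ) v = A γ (A δ v) := fun γ δ v => by rw [map_mul]; rfl
  have hA1 : ∀ v, A 1 v = v := fun v => by rw [map_one]; rfl
  -- The norm pulled back along `v ↦ (A γ v)_γ` comes from the averaged inner product; the group
  -- only permutes the coordinates.
  let J : Euc n →ₗ[ℝ] PiLp 2 (fun _ : S => Euc n) :=
    (WithLp.linearEquiv 2 ℝ (S → Euc n)).symm.toLinearMap ∘ₗ
      LinearMap.pi fun γ => (A γ).toLinearMap
  have hJ : ∀ v γ, J v γ = A γ v := fun v γ => rfl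
  have hJinj : Function.Injective J := by
    intro v w h
    have := congrArg (fun z : PiLp 2 (fun _ : S => Euc n) => z 1) h
    simpa only [hJ, hA1] using this
  have hJnorm : ∀ γ v, ‖J (A γ v)‖ = ‖J v‖ := by
    intro γ v
    rw [PiLp.norm_eq_of_L2, PiLp.norm_eq_of_L2]
    congr 1
    refine Fintype.sum_equiv (Equiv.mulRight γ) _ _ fun δ => ?_
    rw [hJ, hJ, ← hA]
    rfl
  let R := LinearMap.range J
  have hR : Module.finrank ℝ R = n := by
    rw [LinearMap.finrank_range_of_inj hJinj, finrank_euclideanSpace_fin]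
  let I : R ≃ₗᵢ[ℝ] Euc n := ((stdOrthonormalBasis ℝ R).reindex (finCongr hR)).repr
  let T : Euc n ≃ₗ[ℝ] Euc n := (LinearEquiv.ofInjective J hJinj).trans I.toLinearEquiv
  have hT : ∀ v, ‖T v‖ = ‖J v‖ := fun v => I.norm_map _
  let f : S → (Euc n →ₗ[ℝ] Euc n) := fun γ => T.toLinearMap ∘ₗ (A γ).toLinearMap ∘ₗ T.symm
  have hf : ∀ γ v, f γ v = T (A γ (T.symm v)) := fun γ v => rfl
  have hfmul : ∀ γ δ v, f γ (f δ v) = f (γ * δ) v := fun γ δ v => by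
    rw [hf, hf, hf, T.symm_apply_apply, hA]
  have hf1 : ∀ v, f 1 v = v := fun v => by rw [hf, hA1, T.apply_symm_apply]
  let ρ : S → (Euc n ≃ₗᵢ[ℝ] Euc n) := fun γ =>
    { toLinearEquiv := LinearEquiv.ofLinearMap (f γ) (f γ⁻¹)
        (by ext1 v; simp [hfmul, hf1]) (by ext1 v; simp [hfmul, hf1])
      norm_map' := fun v => by
        change ‖f γ v‖ = ‖v‖
        rw [hf, hT, hJnorm, ← hT, T.apply_symm_apply] }
  have hρ : ∀ γ v, ρ γ v = f γ v := fun γ v => rfl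
  refine ⟨T.toContinuousLinearEquiv, ⟨⟨ρ, ?_⟩, ?_⟩, ?_⟩
  · ext1 v
    rw [hρ, hf1]
    rfl
  · intro γ δ
    ext1 v
    rw [hρ, ← hfmul]
    rfl
  · intro γ v
    change f γ (T v) = T (A γ v)
    rw [hf, T.symm_apply_apply]

namespace OrbifoldChart

variable {n : ℕ} {X : Type*} [TopologicalSpace X] (c : OrbifoldChart n X) {x : Euc n}

/-- The stabilizer of a point of a chart, as a subgroup. -/
def stabilizer (hx : x ∈ c.V) : Subgroup c.Γ where
  carrier := c.stab x
  one_mem' := c.act_one x hx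
  mul_mem' := by
    intro γ δ (hγ : c.act γ x = x) (hδ : c.act δ x = x)
    change c.act (γ * δ) x = x
    rw [c.act_mul _ _ x hx, hδ, hγ]
  inv_mem' := by
    intro γ (hγ : c.act γ x = x)
    change c.act γ⁻¹ x = x
    conv_lhs => rw [← hγ]
    exact c.act_inv_act γ hx

variable {c}

theorem act_eq_of_mem_stabilizer (hx : x ∈ c.V) (γ : c.stabilizer hx) : c.act γ x = x := γ.2

theorem contDiffAt_act (hx : x ∈ c.V) (γ : c.Γ) : ContDiffAt ℝ ∞ (c.act γ) x :=
  (c.act_smooth γ).contDiffAt (c.isOpen_V.mem_nhds hx)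

theorem differentiableAt_act (hx : x ∈ c.V) (γ : c.Γ) : DifferentiableAt ℝ (c.act γ) x :=
  (contDiffAt_act hx γ).differentiableAt (by simp)

/-- The linear action of the stabilizer on the tangent space. -/
noncomputable def tangentAction (hx : x ∈ c.V) : c.stabilizer hx →* (Euc n →L[ℝ] Euc n) where
  toFun γ := fderiv ℝ (c.act γ) x
  map_one' := by
    have h : c.act 1 =ᶠ[𝓝 x] id :=
      eventually_of_mem (c.isOpen_V.mem_nhds hx) fun y hy => c.act_one y hy
    exact h.fderiv_eq.trans fderiv_id
  map_mul' γ δ := by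
    have h : c.act (γ * δ : c.stabilizer hx) =ᶠ[𝓝 x] c.act γ ∘ c.act δ :=
      eventually_of_mem (c.isOpen_V.mem_nhds hx) fun y hy => c.act_mul _ _ y hy
    have hδ := act_eq_of_mem_stabilizer hx δ
    rw [h.fderiv_eq, fderiv_comp x (by rw [hδ]; exact differentiableAt_act hx _)
      (differentiableAt_act hx _), hδ]
    rfl

/-- Averaging the coordinate `y - x` over the stabilizer, twisted by the inverse tangent action,
gives an equivariant map whose derivative at `x` is the group order times the identity; `T` then
makes the action isometric. -/
theorem exists_equivariant_coordinates (hx : x ∈ c.V) :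
    ∃ (ρ : c.stabilizer hx →* (Euc n ≃ₗᵢ[ℝ] Euc n)) (ψ : Euc n → Euc n),
      ContDiffOn ℝ ∞ ψ c.V ∧ ψ x = 0 ∧ Function.Injective (fderiv ℝ ψ x) ∧
      ∀ γ : c.stabilizer hx, ∀ y ∈ c.V, ψ (c.act γ y) = ρ γ (ψ y) := by
  classical
  have := Fintype.ofFinite (c.stabilizer hx)
  let A := tangentAction hx
  have hA : ∀ γ δ v, A (γ * δ) v = A γ (A δ v) := fun γ δ v => by rw [map_mul]; rfl
  have hA1 : ∀ v, A 1 v = v := fun v => by rw [map_one]; rfl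
  obtain ⟨T, ρ, hT⟩ := exists_unitarization A
  let ψ₀ : Euc n → Euc n := fun y => ∑ γ : c.stabilizer hx, A γ⁻¹ (c.act γ y - x)
  have hψ₀ : ContDiffOn ℝ ∞ ψ₀ c.V := ContDiffOn.sum fun γ _ =>
    (A γ⁻¹).contDiff.comp_contDiffOn ((c.act_smooth γ).sub contDiffOn_const)
  refine ⟨ρ, T ∘ ψ₀, T.contDiff.comp_contDiffOn hψ₀, ?_, ?_, ?_⟩
  · have : ψ₀ x = 0 := Finset.sum_eq_zero fun γ _ => by
      rw [act_eq_of_mem_stabilizer hx γ, sub_self, map_zero]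
    rw [Function.comp_apply, this, map_zero]
  · have h1 : HasFDerivAt ψ₀ (∑ γ : c.stabilizer hx, (A γ⁻¹).comp (A γ)) x :=
      HasFDerivAt.fun_sum fun γ _ => (A γ⁻¹).hasFDerivAt.comp x
        ((differentiableAt_act hx γ).hasFDerivAt.sub_const x)
    have h2 : ∀ v, (∑ γ : c.stabilizer hx, (A γ⁻¹).comp (A γ)) v =
        Fintype.card (c.stabilizer hx) • v := fun v => by
      rw [_root_.sum_apply]
      simp only [ContinuousLinearMap.comp_apply, ← hA, inv_mul_cancel, hA1, Finset.sum_const,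
        Finset.card_univ]
    have h3 : HasFDerivAt (T ∘ ψ₀) _ x := T.hasFDerivAt.comp x h1
    rw [h3.fderiv, injective_iff_map_eq_zero]
    intro v hv
    have hv' : T (Fintype.card (c.stabilizer hx) • v) = 0 := by
      rw [← h2]
      exact hv
    rw [map_eq_zero_iff T T.injective] at hv'
    rw [← Nat.cast_smul_eq_nsmul ℝ] at hv'
    exact (smul_eq_zero.1 hv').resolve_left (Nat.cast_ne_zero.2 Fintype.card_ne_zero)
  · intro δ y hy
    have h : ψ₀ (c.act δ y) = A δ (ψ₀ y) := by
      simp only [ψ₀, map_sum]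
      refine Fintype.sum_equiv (Equiv.mulRight δ) _ _ fun γ => ?_
      rw [← hA]
      simp only [Equiv.coe_mulRight, mul_inv_rev, mul_inv_cancel_left, Subgroup.coe_mul]
      rw [c.act_mul _ _ y hy]
    rw [Function.comp_apply, Function.comp_apply, h, hT]

/-- A linear model for the action near a point of a chart. -/
theorem exists_linearization (hx : x ∈ c.V) {W : Set (Euc n)} (hW : W ∈ 𝓝 x) :
    ∃ (ρ : c.stabilizer hx →* (Euc n ≃ₗᵢ[ℝ] Euc n)) (r : ℝ)
      (e : OpenPartialHomeomorph (Euc n) (Euc n)), 0 < r ∧ e.IsDiffeo ∧ x ∈ e.source ∧ e x = 0 ∧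
      e.source ⊆ c.V ∧ e.source ⊆ W ∧ e.target = ball 0 r ∧
      (∀ γ : c.stabilizer hx, ∀ y ∈ e.source, c.act γ y ∈ e.source ∧ e (c.act γ y) = ρ γ (e y)) ∧
      ∀ γ, c.act γ x ≠ x → ∀ y ∈ e.source, c.act γ y ∉ e.source := by
  obtain ⟨ρ, ψ, hψ, hψx, hinj, hequiv⟩ := exists_equivariant_coordinates hx
  obtain ⟨e₀, he₀, hx₀, hsV, hψe⟩ := exists_isDiffeo_of_injective_fderiv c.isOpen_V hψ hx hinj
  have hsep : ∀ γ, ∃ P : Set (Euc n), P ∈ 𝓝 x ∧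
      (c.act γ x ≠ x → ∀ᶠ y in 𝓝 x, c.act γ y ∉ P) := by
    intro γ
    by_cases h : c.act γ x = x
    · exact ⟨univ, univ_mem, fun h' => absurd h h'⟩
    · obtain ⟨P, Q, hP, hQ, hxP, hxQ, hPQ⟩ := t2_separation (Ne.symm h)
      refine ⟨P, hP.mem_nhds hxP, fun _ => ?_⟩
      filter_upwards [(contDiffAt_act hx γ).continuousAt.preimage_mem_nhds (hQ.mem_nhds hxQ)]
        with y hy hyP
      exact Set.disjoint_left.1 hPQ hyP hy
  choose P hP hPsep using hsep
  have hE : ∀ᶠ y in 𝓝 x, y ∈ W ∧ (∀ γ : c.stabilizer hx, c.act γ y ∈ e₀.source) ∧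
      (∀ γ, y ∈ P γ) ∧ ∀ γ, c.act γ x ≠ x → c.act γ y ∉ P γ := by
    refine Filter.Eventually.and hW (Filter.Eventually.and (eventually_all.2 fun γ => ?_)
      (Filter.Eventually.and (eventually_all.2 hP) (eventually_all.2 fun γ => ?_)))
    · refine (contDiffAt_act hx (γ : c.Γ)).continuousAt.preimage_mem_nhds ?_
      rw [act_eq_of_mem_stabilizer hx γ]
      exact e₀.open_source.mem_nhds hx₀
    · by_cases h : c.act γ x = x
      · exact Eventually.of_forall fun y h' => absurd h h'
      · exact (hPsep γ h).mono fun y hy _ => hy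
  have he₀x : e₀ x = 0 := (hψe x).trans hψx
  have h0t : (0 : Euc n) ∈ e₀.target := he₀x ▸ e₀.map_source hx₀
  have h0s : e₀.symm 0 = x := by rw [← he₀x, e₀.left_inv hx₀]
  have htend : Tendsto e₀.symm (𝓝 0) (𝓝 x) := by
    have := e₀.continuousAt_symm h0t
    rwa [ContinuousAt, h0s] at this
  have hev := htend.eventually hE
  obtain ⟨r, hr, hball⟩ := Metric.eventually_nhds_iff_ball.1
    (hev.and (e₀.open_target.mem_nhds h0t))
  -- Balls are invariant under isometries, so cutting down to one in the target yields a source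
  -- stable under the stabilizer.
  let e := (e₀.symm.restrOpen (ball 0 r) isOpen_ball).symm
  have hsource : ∀ y, y ∈ e.source ↔ y ∈ e₀.source ∧ e₀ y ∈ ball 0 r := fun y => Iff.rfl
  have htarget : e.target = ball 0 r := by
    change e₀.target ∩ ball 0 r = ball 0 r
    exact inter_eq_right.2 fun z hz => (hball z hz).2
  have he : ∀ y, e y = ψ y := hψe
  have hprop := fun y (hy : y ∈ e.source) => (hball (e₀ y) hy.2).1
  have hleft : ∀ y ∈ e.source, e₀.symm (e₀ y) = y := fun y hy => e₀.left_inv hy.1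
  refine ⟨ρ, r, e, hr, (he₀.symm.restrOpen isOpen_ball).symm, ?_, he₀x, fun y hy => hsV hy.1,
    fun y hy => ?_, htarget, fun γ y hy => ⟨?_, ?_⟩, fun γ hγ y hy hy' => ?_⟩
  · rw [hsource, he₀x]
    exact ⟨hx₀, mem_ball_self hr⟩
  · have := (hprop y hy).1
    rwa [hleft y hy] at this
  · have h1 := (hprop y hy).2.1 γ
    rw [hleft y hy] at h1
    refine (hsource _).2 ⟨h1, ?_⟩
    have h2 : e₀ y ∈ ball 0 r := hy.2
    rw [hψe] at h2 ⊢
    rw [hequiv γ y (hsV hy.1)]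
    simpa using h2
  · rw [he, he, hequiv γ y (hsV hy.1)]
  · have h1 := (hprop y hy).2.2.2 γ hγ
    have h2 := (hprop _ hy').2.2.1 γ
    rw [hleft _ hy] at h1
    rw [hleft _ hy'] at h2
    exact h1 h2

end OrbifoldChart

/-! ### From good jets to stability, and the induction on stabilizers. -/

section NotBad

variable {n : ℕ} {L : Submodule ℝ (Euc n)} {F : Euc n → ℝ} {x : Euc n}

theorem inv_norm_smul_mem_sphere {v : Euc n} (hv : v ≠ 0) : ‖v‖⁻¹ • v ∈ sphere (0 : Euc n) 1 := by
  rw [mem_sphere_zero_iff_norm, norm_smul, norm_inv, norm_norm,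
    inv_mul_cancel₀ (norm_ne_zero_iff.2 hv)]

theorem nondegenerate_of_notMem_badJets (h : jet F x ∉ badJets L) (hc : fderiv ℝ F x = 0)
    {v : Euc n} (hv : ∀ w, hessian F x v w = 0) : v = 0 := by
  by_contra hv0
  refine h ⟨hc, Or.inl ⟨_, inv_norm_smul_mem_sphere hv0, ?_⟩⟩
  change hessian F x (‖v‖⁻¹ • v) = 0
  have : hessian F x v = 0 := by
    ext w
    exact hv w
  rw [map_smul, this, smul_zero]

theorem positive_of_notMem_badJets (h : jet F x ∉ badJets L) (hc : fderiv ℝ F x = 0)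
    (hx : x ∈ L) {v : Euc n} (hvL : v ∈ Lᗮ) (hv0 : v ≠ 0) : 0 < hessian F x v v := by
  by_contra! hle
  refine h ⟨hc, Or.inr ⟨hx, _, inv_norm_smul_mem_sphere hv0, Lᗮ.smul_mem _ hvL, ?_⟩⟩
  change hessian F x (‖v‖⁻¹ • v) (‖v‖⁻¹ • v) ≤ 0
  rw [map_smul, map_smul, smul_apply, smul_eq_mul, smul_eq_mul, ← mul_assoc]
  exact mul_nonpos_of_nonneg_of_nonpos (by positivity) hle

end NotBad

namespace OrbifoldStructure

variable {n : ℕ} {X : Type*} [TopologicalSpace X] {O : OrbifoldStructure n X} {k : ℕ∞}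

/-- Stability can be checked in coordinates that linearize the action of the stabilizer. -/
theorem isStableAt_of_linear {c : OrbifoldChart n X} (hc : O.IsChart c) {z : Euc n}
    (hz : z ∈ c.V) {e : OpenPartialHomeomorph (Euc n) (Euc n)} (he : e.IsDiffeo)
    (hze : z ∈ e.source) {f : X → ℝ} {G : Euc n → ℝ} (hfG : f ∘ c.φ =ᶠ[𝓝 z] G ∘ e)
    (hG : ContDiffAt ℝ 2 G (e z)) (hcrit : fderiv ℝ G (e z) = 0) {L : Submodule ℝ (Euc n)}
    (hblock : ∀ l ∈ L, ∀ m ∈ Lᗮ, hessian G (e z) l m = 0)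
    (hpos : ∀ m ∈ Lᗮ, m ≠ 0 → 0 < hessian G (e z) m m)
    (hact : ∀ γ ∈ c.stab z, ∃ A : Euc n ≃ₗᵢ[ℝ] Euc n,
      (∀ᶠ y in 𝓝 z, e (c.act γ y) = A (e y)) ∧ ∀ l ∈ L, A l = l) :
    O.IsStableAt f (c.φ z) := by
  let E : Euc n →L[ℝ] Euc n := fderiv ℝ e z
  have hEinj : Function.Injective E := he.fderiv_injective hze
  let I : Euc n →L[ℝ] Euc n →L[ℝ] ℝ := innerSL ℝ
  -- The Euclidean inner product pulled back by the coordinates, invariant because the action there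
  -- is isometric.
  let B : Euc n →L[ℝ] Euc n →L[ℝ] ℝ := I.bilinearComp E E
  have hB : ∀ v w, B v w = ⟪E v, E w⟫_ℝ := fun v w => rfl
  have hEact : ∀ γ ∈ c.stab z, ∀ A : Euc n ≃ₗᵢ[ℝ] Euc n,
      (∀ᶠ y in 𝓝 z, e (c.act γ y) = A (e y)) → ∀ v, E (fderiv ℝ (c.act γ) z v) = A (E v) := by
    intro γ hγ A hA v
    have hγz : c.act γ z = z := hγ
    have h1 : e ∘ c.act γ =ᶠ[𝓝 z] A ∘ e := hA
    have h2 := h1.fderiv_eq (𝕜 := ℝ)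
    rw [fderiv_comp z (by rw [hγz]; exact he.differentiableAt hze)
      (OrbifoldChart.differentiableAt_act hz γ), hγz,
      fderiv_comp z A.differentiableAt (he.differentiableAt hze)] at h2
    have h3 : fderiv ℝ A (e z) = (A : Euc n →L[ℝ] Euc n) := A.toContinuousLinearEquiv.fderiv
    rw [h3] at h2
    exact congrArg (fun S => S v) h2
  refine ⟨c, hc, z, hz, rfl, B, ⟨fun v w => ?_, fun v hv => ?_, fun γ hγ v w => ?_⟩, ?_⟩
  · rw [hB, hB, real_inner_comm]
  · rw [hB]
    exact real_inner_self_pos.2 fun h => hv (hEinj (h.trans (map_zero E).symm))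
  · obtain ⟨A, hA, -⟩ := hact γ hγ
    rw [hB, hB, hEact γ hγ A hA, hEact γ hγ A hA, LinearIsometryEquiv.inner_map_map]
  · intro γ hγ v hv
    obtain ⟨A, hA, hAL⟩ := hact γ hγ
    suffices hle : negEigenspace B (hessian (f ∘ c.φ) z) ≤ L.comap E.toLinearMap by
      apply hEinj
      rw [hEact γ hγ A hA]
      exact hAL _ (hle hv)
    refine Submodule.span_le.2 ?_
    rintro v ⟨μ, hμ, hv⟩
    have hQ : ∀ w, hessian G (e z) (E v) w = μ * ⟪E v, w⟫_ℝ := by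
      intro w
      have h := hv (fderiv ℝ e.symm (e z) w)
      rw [hessian_congr hfG,
        hessian_comp_of_critical (he.contDiffAt' (k := 2) hze) hG hcrit, hB] at h
      rwa [show E (fderiv ℝ e.symm (e z) w) = w from he.fderiv_comp_symm hze w] at h
    change E v ∈ L
    have hd := add_starProjection_orthogonal L (E v)
    have hl := L.starProjection_apply_mem (E v)
    have hm := Lᗮ.starProjection_apply_mem (E v)
    have hm0 : Lᗮ.starProjection (E v) = 0 := by
      -- Pairing the eigenvector equation with its normal component `m` gives `hessian G (e z) m m =
      -- μ * ⟪m, m⟫_ℝ`, which is nonpositive, against positivity across `L`.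
      by_contra hne
      have h1 := hpos _ hm hne
      have h2 := hQ (Lᗮ.starProjection (E v))
      set l := L.starProjection (E v)
      set m := Lᗮ.starProjection (E v)
      rw [← hd, map_add, add_apply, hblock l hl m hm, zero_add, inner_add_left, hm l hl,
        zero_add] at h2
      rw [h2] at h1
      exact absurd h1 (mul_nonpos_of_nonpos_of_nonneg hμ.le real_inner_self_nonneg).not_gt
    rw [hm0, add_zero] at hd
    rwa [← hd]

/-- A Morse function can be modified near a critical point so that the new critical points are
stable or have smaller stabilizers. -/
theorem exists_modification [T2Space X] (hk : 2 ≤ k) {f : X → ℝ} (hf : O.IsMorse k f)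
    {c : OrbifoldChart n X} (hc : O.IsChart c) {x : Euc n} (hx : x ∈ c.V)
    (hcrit : O.IsCritical f (c.φ x)) {N : Set X} (hN : IsOpen N) (hxN : c.φ x ∈ N)
    (honly : ∀ q ∈ N, O.IsCritical f q → q = c.φ x) {δ : ℝ} (hδ : 0 < δ) :
    ∃ f' : X → ℝ, O.IsMorse k f' ∧ closure {q | f' q ≠ f q} ⊆ N ∧ (∀ q, |f' q - f q| < δ) ∧
      ∀ q ∈ N, O.IsCritical f' q → O.IsStableAt f' q ∨
        ∃ z ∈ c.V, c.φ z = q ∧ (c.stab z).ncard < (c.stab x).ncard := by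
  classical
  obtain ⟨ρ, r, e, hr, he, hxe, hex, hsV, hsN, htarget, hact, hsep⟩ :=
    c.exists_linearization hx ((c.continuousAt_φ hx).preimage_mem_nhds (hN.mem_nhds hxN))
  have := Fintype.ofFinite (c.stabilizer hx)
  have htgt : ∀ y ∈ ball (0 : Euc n) r, y ∈ e.target := fun y hy => htarget ▸ hy
  have h0r : (0 : Euc n) ∈ ball 0 r := mem_ball_self hr
  have he0 : e.symm 0 = x := by rw [← hex, e.left_inv hxe]
  have hsame : ∀ z ∈ e.source, ∀ z' ∈ e.source, c.φ z = c.φ z' →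
      ∃ γ : c.stabilizer hx, c.act γ z = z' := by
    intro z hz z' hz' h
    obtain ⟨γ, hγ⟩ := (c.φ_eq_iff z (hsV hz) z' (hsV hz')).1 h
    have hγx : c.act γ x = x := by
      by_contra hne
      exact hsep γ hne z hz (hγ ▸ hz')
    exact ⟨⟨γ, hγx⟩, hγ⟩
  let g : Euc n → ℝ := (f ∘ c.φ) ∘ e.symm
  have hgm : ∀ y ∈ ball (0 : Euc n) r, MorseAt k g y := fun y hy =>
    he.symm.morseAt_comp (htgt y hy) hk (hf.morseAt hc (hsV (e.map_target (htgt y hy))))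
  have hg2 : ∀ y ∈ ball (0 : Euc n) r, ContDiffAt ℝ 2 g y := fun y hy =>
    (hgm y hy).contDiffAt_two hk
  have hgcrit : ∀ y ∈ ball (0 : Euc n) r,
      (fderiv ℝ g y = 0 ↔ O.IsCritical f (c.φ (e.symm y))) := fun y hy => by
    have hz := hsV (e.map_target (htgt y hy))
    rw [isCritical_iff hk hf hc hz]
    exact he.symm.fderiv_comp_eq_zero_iff (htgt y hy)
      (((hf.morseAt hc hz).contDiffAt_two hk).differentiableAt (by norm_num))
  have hguniq : ∀ y ∈ ball (0 : Euc n) r, fderiv ℝ g y = 0 → y = 0 := fun y hy h => by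
    have hz := e.map_target (htgt y hy)
    have heq := honly _ (hsN hz) ((hgcrit y hy).1 h)
    obtain ⟨γ, hγ⟩ := hsame x hxe _ hz heq.symm
    rw [← e.right_inv (htgt y hy), ← hγ, OrbifoldChart.act_eq_of_mem_stabilizer hx γ, hex]
  have hginv : ∀ γ, ∀ y ∈ ball (0 : Euc n) r, g (ρ γ y) = g y := fun γ y hy => by
    have hz := e.map_target (htgt y hy)
    obtain ⟨h1, h2⟩ := hact γ _ hz
    rw [e.right_inv (htgt y hy)] at h2
    change f (c.φ (e.symm (ρ γ y))) = f (c.φ (e.symm y))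
    rw [← h2, e.left_inv h1, c.φ_act _ (hsV hz)]
  have hg0 : fderiv ℝ g 0 = 0 := by
    rw [hgcrit 0 h0r, he0]
    exact hcrit
  obtain ⟨u, hu, huδ, hgood⟩ := exists_linear_step (ρ := ρ) (half_pos hr) (half_lt_self hr)
    hg2 hginv hguniq hg0 ((hgm 0 h0r).2 hg0) hδ
  have hηr : closedBall (0 : Euc n) (r / 2) ⊆ ball 0 r := closedBall_subset_ball (half_lt_self hr)
  have hfar : ∀ y, y ∉ closedBall (0 : Euc n) (r / 2) → g + u =ᶠ[𝓝 y] g := fun y hy => by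
    have hsupp : y ∉ tsupport u := fun h => hy (ball_subset_closedBall (hu.2.2 h))
    filter_upwards [notMem_tsupport_iff_eventuallyEq.1 hsupp] with y' hy'
    rw [Pi.add_apply, hy', Pi.zero_apply, add_zero]
  have hnear : ∀ y ∈ ball (0 : Euc n) r, fderiv ℝ (g + u) y = 0 →
      y ∈ closedBall (0 : Euc n) (r / 2) := fun y hy h => by
    by_contra hne
    rw [(hfar y hne).fderiv_eq] at h
    rw [hguniq y hy h] at hne
    exact hne (mem_closedBall_self (half_pos hr).le)
  have hum : ∀ y ∈ ball (0 : Euc n) r, MorseAt k (g + u) y := fun y hy =>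
    ⟨(hgm y hy).1.add (hu.1.contDiffAt.of_le (by exact_mod_cast le_top)), fun h v hv =>
      nondegenerate_of_notMem_badJets (hgood y (hnear y hy h)) h hv⟩
  -- The perturbation descends to `X`: two lifts in `e.source` differ by the stabilizer of `x`,
  -- under which `u` is invariant, so the chosen lift does not matter.
  let v : X → ℝ := fun q => if h : ∃ z ∈ e.source, c.φ z = q then u (e h.choose) else 0
  have hv : ∀ z ∈ e.source, v (c.φ z) = u (e z) := by
    intro z hz
    have h : ∃ z' ∈ e.source, c.φ z' = c.φ z := ⟨z, hz, rfl⟩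
    obtain ⟨γ, hγ⟩ := hsame _ h.choose_spec.1 z hz h.choose_spec.2
    simp only [v, dif_pos h]
    rw [← hu.2.1 γ, ← (hact γ _ h.choose_spec.1).2, hγ]
  have hsuppr : tsupport u ⊆ ball 0 r := hu.2.2.trans (ball_subset_closedBall.trans hηr)
  let K : Set X := c.φ '' (e.symm '' tsupport u)
  -- Compactness makes `K` closed in the Hausdorff space `X`, so extension by zero keeps `f + v`
  -- locally equal to `f` off `K`.
  have hKcpt : IsCompact K := by
    have h1 : IsCompact (tsupport u) := hasCompactSupport_of_tsupport_subset hu.2.2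
    have h2 : IsCompact (e.symm '' tsupport u) := h1.image_of_continuousOn
      (e.continuousOn_symm.mono fun y hy => htgt y (hsuppr hy))
    refine h2.image_of_continuousOn (c.φ_continuousOn.mono ?_)
    rintro _ ⟨y, hy, rfl⟩
    exact hsV (e.map_target (htgt y (hsuppr hy)))
  have hKs : ∀ q ∈ K, ∃ z ∈ e.source, c.φ z = q := by
    rintro _ ⟨_, ⟨y, hy, rfl⟩, rfl⟩
    exact ⟨_, e.map_target (htgt y (hsuppr hy)), rfl⟩
  have hvK : ∀ q, q ∉ K → v q = 0 := by
    intro q hq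
    by_cases h : ∃ z ∈ e.source, c.φ z = q
    · obtain ⟨z, hz, rfl⟩ := h
      rw [hv z hz]
      by_contra hne
      exact hq ⟨z, ⟨e z, subset_tsupport u hne, e.left_inv hz⟩, rfl⟩
    · simp only [v, dif_neg h]
  have hev : ∀ q, q ∉ K → f =ᶠ[𝓝 q] f + v := fun q hq => by
    filter_upwards [hKcpt.isClosed.isOpen_compl.mem_nhds hq] with q' hq'
    rw [Pi.add_apply, hvK q' hq', add_zero]
  have hrep : ∀ z ∈ e.source, (f + v) ∘ c.φ =ᶠ[𝓝 z] (g + u) ∘ e := fun z hz => by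
    filter_upwards [e.open_source.mem_nhds hz] with z' hz'
    change f (c.φ z') + v (c.φ z') = f (c.φ (e.symm (e z'))) + u (e z')
    rw [hv z' hz', e.left_inv hz']
  have her : ∀ z ∈ e.source, e z ∈ ball (0 : Euc n) r := fun z hz => htarget ▸ e.map_source hz
  have hmorse : O.IsMorse k (f + v) := by
    refine isMorse_of_forall_exists hk fun q => ?_
    by_cases h : ∃ z ∈ e.source, c.φ z = q
    · obtain ⟨z, hz, rfl⟩ := h
      exact ⟨c, hc, z, hsV hz, rfl,
        (he.morseAt_comp hz hk (hum _ (her z hz))).congr (hrep z hz).symm⟩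
    · obtain ⟨c', hc', x', hx', rfl⟩ := O.covers q
      exact ⟨c', isChart_of_mem_atlas hc', x', hx', rfl,
        (hf.morseAt (isChart_of_mem_atlas hc') hx').congr
          (c'.comp_φ_eventuallyEq hx' (hev _ fun hK => h (hKs _ hK)))⟩
  refine ⟨f + v, hmorse, ?_, fun q => ?_, fun q hq hqc => ?_⟩
  · refine (closure_minimal (fun q hq => ?_) hKcpt.isClosed).trans fun q hq => ?_
    · by_contra hqK
      exact hq (by rw [Pi.add_apply, hvK q hqK, add_zero])
    · obtain ⟨z, hz, rfl⟩ := hKs q hq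
      exact hsN hz
  · rw [Pi.add_apply, add_sub_cancel_left]
    by_cases h : ∃ z ∈ e.source, c.φ z = q
    · obtain ⟨z, hz, rfl⟩ := h
      rw [hv z hz]
      exact huδ _
    · rw [hvK q fun hK => h (hKs q hK), abs_zero]
      exact hδ
  · obtain ⟨z, hz, rfl⟩ : ∃ z ∈ e.source, c.φ z = q := by
      by_contra h
      have hqf := hqc.congr (hev q fun hK => h (hKs q hK)).symm
      exact h ⟨x, hxe, (honly q hq hqf).symm⟩
    have hyr := her z hz
    have hyc : fderiv ℝ (g + u) (e z) = 0 := by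
      rw [isCritical_iff hk hmorse hc (hsV hz), (hrep z hz).fderiv_eq] at hqc
      exact (he.fderiv_comp_eq_zero_iff hz
        (((hum _ hyr).contDiffAt_two hk).differentiableAt (by norm_num))).1 hqc
    have hsub : c.stab z ⊆ c.stab x := by
      intro γ hγ
      have hγz : c.act γ z = z := hγ
      by_contra hne
      exact hsep γ hne z hz (hγz.symm ▸ hz)
    -- On the fixed subspace positivity gives stability; off it some element of the stabilizer of
    -- `x` moves `z`, so its stabilizer is strictly smaller.
    by_cases hfix : e z ∈ fixedSubspace ρ ⊤
    · left
      have hnb := hgood (e z) (hnear _ hyr hyc)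
      have h2 : ContDiffAt ℝ 2 (g + u) (e z) := (hum _ hyr).contDiffAt_two hk
      have hinv : ∀ γ ∈ (⊤ : Subgroup (c.stabilizer hx)),
          ∀ᶠ y in 𝓝 (e z), (g + u) (ρ γ y) = (g + u) y := fun γ _ => by
        filter_upwards [isOpen_ball.mem_nhds hyr] with y hy
        rw [Pi.add_apply, Pi.add_apply, hginv γ y hy, hu.2.1 γ y]
      refine isStableAt_of_linear hc (hsV hz) he hz (hrep z hz) h2 hyc
        (L := fixedSubspace ρ ⊤) (fun l hl m hm => (hessian_block h2 hfix hinv hyc hl hm).1)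
        (fun m hm hm0 => positive_of_notMem_badJets hnb hyc hfix hm hm0) fun γ hγ => ?_
      refine ⟨ρ ⟨γ, hsub hγ⟩, ?_, fun l hl => hl _ trivial⟩
      filter_upwards [e.open_source.mem_nhds hz] with y hy
      exact (hact ⟨γ, hsub hγ⟩ y hy).2
    · right
      refine ⟨z, hsV hz, rfl, Set.ncard_lt_ncard ?_ (Set.toFinite _)⟩
      refine ⟨hsub, fun hsup => hfix fun γ _ => ?_⟩
      have hγz : c.act γ z = z := hsup γ.2
      rw [← (hact γ z hz).2, hγz]

/-- Every Morse function can be made stable near each point. -/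
theorem stabilizable [T2Space X] [ParacompactSpace X] (hk : 2 ≤ k) {c : OrbifoldChart n X}
    (hc : O.IsChart c) {x : Euc n} (hx : x ∈ c.V) {f : X → ℝ} (hf : O.IsMorse k f) :
    O.Stabilizable k f (c.φ x) := by
  induction hm : (c.stab x).ncard using Nat.strong_induction_on generalizing x f with
  | _ m ih =>
    intro N hN hxN honly δ hδ
    by_cases hcrit : O.IsCritical f (c.φ x)
    · obtain ⟨f₁, hf₁, hcl₁, hδ₁, hcrit₁⟩ :=
        exists_modification hk hf hc hx hcrit hN hxN honly (half_pos hδ)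
      obtain ⟨f₂, hf₂, hcl₂, hδ₂, hcrit₂⟩ := exists_stable_of_forall_stabilizable hk hf₁ hN
        (fun q hq hqc => by
          rcases hcrit₁ q hq hqc with hst | ⟨z, hz, rfl, hlt⟩
          -- An already stable point needs no modification, being the only critical point of `f₁` in
          -- `N'`.
          · intro N' _ _ honly' δ' hδ'
            refine ⟨f₁, hf₁, by simp, fun _ => by simpa using hδ', fun q' hq' hc' => ?_⟩
            rwa [honly' q' hq' hc']
          · exact ih _ (hm ▸ hlt) hz hf₁ rfl)
        (continuous_const (y := δ / 2)) (fun _ => half_pos hδ)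
      refine ⟨f₂, hf₂, ?_, fun q => ?_, hcrit₂⟩
      · have hsub : {q | f₂ q ≠ f q} ⊆ {q | f₁ q ≠ f q} ∪ {q | f₂ q ≠ f₁ q} := by
          intro q hq
          by_contra h
          simp only [mem_union, mem_ofPred_eq, not_or, not_not] at h
          exact hq (h.2.trans h.1)
        refine (closure_mono hsub).trans ?_
        rw [closure_union]
        exact union_subset hcl₁ hcl₂
      · have h := abs_sub_le (f₂ q) (f₁ q) (f q)
        have h1 := hδ₁ q
        have h2 := hδ₂ q
        linarith
    · refine ⟨f, hf, by simp, fun _ => by simpa using hδ, fun q hq hqc => ?_⟩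
      rw [honly q hq hqc] at hqc
      exact absurd hqc hcrit

end OrbifoldStructure

/-! ### The global statement. -/

theorem mainTheorem5 {n : ℕ} {X : Type*} [TopologicalSpace X] [T2Space X] [ParacompactSpace X]
    (O : OrbifoldStructure n X) (k : ℕ∞) (hk : 2 ≤ k) (f : X → ℝ) (hf : O.IsMorse k f)
    (ε : X → ℝ) (hε : Continuous ε) (hε_pos : ∀ x, 0 < ε x)
    (U : Set X) (hU : IsOpen U) (hcrit : ∀ p, O.IsCritical f p → p ∈ U) :
    ∃ f' : X → ℝ, O.IsStableMorse k f' ∧ (∀ x, |f' x - f x| < ε x) ∧ ∀ x, x ∉ U → f' x = f x := by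
  obtain ⟨f', hf', hcl, hclose, hst⟩ :=
    OrbifoldStructure.exists_stable_of_forall_stabilizable hk hf hU (fun p _ _ => by
      obtain ⟨c, hc, x, hx, rfl⟩ := O.covers p
      exact OrbifoldStructure.stabilizable hk (OrbifoldStructure.isChart_of_mem_atlas hc) hx hf)
      hε hε_pos
  refine ⟨f', ⟨hf', fun p hp => ?_⟩, hclose, fun x hx => ?_⟩
  · by_cases hpU : p ∈ U
    · exact hst p hpU hp
    -- The closure of the modified set lies in `U`, so a critical point outside `U` would be one of
    -- `f`, which has none there.
    · have hev : f' =ᶠ[𝓝 p] f := by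
        filter_upwards [isClosed_closure.isOpen_compl.mem_nhds fun h => hpU (hcl h)] with q hq
        by_contra hne
        exact hq (subset_closure hne)
      exact absurd (hcrit p (hp.congr hev)) hpU
  · by_contra hne
    exact hx (hcl (subset_closure hne))
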